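/- Let ${\cal X}$ be a separable real Banach space, ${\bf X}$ a random element of ${\cal X}$, and $\delta\in{\cal X}$, $\delta\neq{\bf 0}$. Let $m,n\to\infty$ in such a way that, with $N=m+n$, $m/N\to\gamma\in(0,1)$. For each pair $(m,n)$ let ${\bf X}_1,\ldots,{\bf X}_m,{\bf Y}_1,\ldots,{\bf Y}_n$ be independent random elements of ${\cal X}$, where each ${\bf X}_i$ is distributed as ${\bf X}$ and each ${\bf Y}_j$ is distributed as ${\bf X}+\Delta_N$ with $\Delta_N=(mn/N)^{-1/2}\delta$ (shrinking location shifts). Let $\bar{\bf X},\bar{\bf Y}$ be the sample means and let $\Sigma$ denote the covariance of ${\bf X}$. (a) Suppose that ${\cal X}$ is of type 2, i.e. there is $b>0$ such that $E\|\sum_{i=1}^k{\bf U}_i\|^2\le b\sum_{i=1}^kE\|{\bf U}_i\|^2$ for all $k$ and all independent zero mean random elements ${\bf U}_1,\ldots,{\bf U}_k$ of ${\cal X}$ with finite second moments. Let $T_{CFF}=m\|\bar{\bf X}-\bar{\bf Y}\|^2$. If $E(\|{\bf X}\|^2)<\infty$, then there is a (unique) Gaussian law $G(\delta,\Sigma)$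 on ${\cal X}$ with mean $\delta$ and covariance $\Sigma$, and $nN^{-1}T_{CFF}$ converges weakly to $\|{\bf W}\|^2$, where ${\bf W}$ has the law $G(\delta,\Sigma)$. (b) Suppose that ${\cal X}$ is a separable real Hilbert space, and let $\lambda_1\ge\lambda_2\ge\cdots$ be the eigenvalues of the covariance operator $\Sigma$ in decreasing order, counted with multiplicity, with corresponding orthonormal eigenvectors $\psi_1,\psi_2,\ldots$. Suppose that for some $L\ge1$, $\lambda_1>\cdots>\lambda_L>\lambda_{L+1}>0$, and that $E(\|{\bf X}\|^4)<\infty$. Let $\widehat\lambda_1\ge\cdots\ge\widehat\lambda_L$ be the $L$ largest eigenvalues, counted with multiplicity, of the empirical pooled covariance $(N-2)^{-1}\{\sum_{i=1}^m({\bf X}_i-\bar{\bf X})\otimes({\bf X}_i-\bar{\bf X})+\sum_{j=1}^n({\bf Y}_j-\bar{\bf Y})\otimes({\bf Y}_j-\bar{\bf Y})\}$, let $\widehat\psi_1,\ldots,\widehat\psi_L$ be any measurable choice of corresponding orthonormal eigenvectors, and put $$T_{HKR1}=\sum_{k=1}^L\langle\bar{\bf X}-\bar{\bf Y},\widehat\psi_k\rangle^2,\qquad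 T_{HKR2}=\sum_{k=1}^L\widehat\lambda_k^{-1}\langle\bar{\bf X}-\bar{\bf Y},\widehat\psi_k\rangle^2 .$$ Then $mnN^{-1}T_{HKR1}$ converges weakly to $\sum_{k=1}^L\lambda_k\chi^2_{(1)}(\beta_k^2/\lambda_k)$ and $mnN^{-1}T_{HKR2}$ converges weakly to $\sum_{k=1}^L\chi^2_{(1)}(\beta_k^2/\lambda_k)$, where $\beta_k=\langle\delta,\psi_k\rangle$ and the $\chi^2_{(1)}(\beta_k^2/\lambda_k)$ are independent noncentral chi-square variables with 1 degree of freedom and noncentrality parameters $\beta_k^2/\lambda_k$. -/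

import Mathlib

open MeasureTheory ProbabilityTheory Filter Topology
open scoped InnerProductSpace

noncomputable section

namespace TwoSample

universe u

/-- A Banach space `E` is of type 2: there is `b > 0` such that
`E‖U₁ + ⋯ + Uₙ‖² ≤ b (E‖U₁‖² + ⋯ + E‖Uₙ‖²)` for all `n` and all independent zero mean random
elements `U₁, …, Uₙ` of `E` with finite second moments. (The condition only depends on the joint
law of the `Uᵢ`, and `Fin n → E` lives in the universe of `E`.) -/
def IsTypeTwo (E : Type u) [NormedAddCommGroup E] [NormedSpace ℝ E] [MeasurableSpace E] : Prop :=
  ∃ b : ℝ, 0 < b ∧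
    ∀ (Ω : Type u) [MeasurableSpace Ω] (P : Measure Ω) [IsProbabilityMeasure P]
      (n : ℕ) (U : Fin n → Ω → E),
      (∀ i, Measurable (U i)) → iIndepFun U P → (∀ i, MemLp (U i) 2 P) →
      (∀ i, ∫ ω, U i ω ∂P = 0) →
      ∫ ω, ‖∑ i, U i ω‖ ^ 2 ∂P ≤ b * ∑ i, ∫ ω, ‖U i ω‖ ^ 2 ∂P

section Banach

variable {E : Type*} [NormedAddCommGroup E] [NormedSpace ℝ E]

/-- The shrinking shift `(mn/N)^{-1/2} δ`, where `N = m + n`. -/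
def shrinkingShift (δ : E) (m n : ℕ) : E :=
  (√((m : ℝ) * n / (m + n)))⁻¹ • δ

/-- `X₁, …, X_m, Y₁, …, Y_n` are independent random elements of `E`, each `Xᵢ` has the law `μ`,
and each `Yⱼ` has the law of `X + Δ`, where `X` has the law `μ`. -/
structure IsShiftedTwoSample {Ω : Type*} [MeasurableSpace Ω] [MeasurableSpace E]
    (P : Measure Ω) (μ : Measure E) (Δ : E) {m n : ℕ}
    (X : Fin m → Ω → E) (Y : Fin n → Ω → E) : Prop where
  law_X : ∀ i, HasLaw (X i) μ P
  law_Y : ∀ j, HasLaw (Y j) (μ.map (fun x => x + Δ)) P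
  indep : iIndepFun (Sum.elim X Y) P

/-- The sample mean. -/
def sampleMean {n : ℕ} (x : Fin n → E) : E :=
  (n : ℝ)⁻¹ • ∑ i, x i

/-- The statistic `T_CFF = m ‖x̄ - ȳ‖²`. -/
def TCFF {m n : ℕ} (x : Fin m → E) (y : Fin n → E) : ℝ :=
  m * ‖sampleMean x - sampleMean y‖ ^ 2

end Banach

section Hilbert

variable {H : Type*} [NormedAddCommGroup H] [InnerProductSpace ℝ H]

/-- The (centred) covariance operator `Σ` of a law `μ`, given by
`⟪Σ x, y⟫ = Cov(⟪x, X⟫, ⟪y, X⟫)` for `X` with law `μ`. -/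
def covOperator [CompleteSpace H] [MeasurableSpace H] [BorelSpace H] (μ : Measure H) : H →L[ℝ] H :=
  InnerProductSpace.continuousLinearMapOfBilin (covarianceBilin μ)

/-- The sum of the centred squares `∑ᵢ (xᵢ - x̄) ⊗ (xᵢ - x̄)` of a sample. -/
def scatterOperator {n : ℕ} (x : Fin n → H) : H →L[ℝ] H :=
  ∑ i, InnerProductSpace.rankOne ℝ (x i - sampleMean x) (x i - sampleMean x)

/-- The empirical pooled covariance of two samples, with the usual normalization `N - 2`. -/
def pooledCov {m n : ℕ} (x : Fin m → H) (y : Fin n → H) : H →L[ℝ] H :=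
  ((m : ℝ) + n - 2)⁻¹ • (scatterOperator x + scatterOperator y)

/-- `lam 0 ≥ lam 1 ≥ ⋯` are the `K` largest eigenvalues of `A`, counted with multiplicity and in
descending order, and `psi 0, psi 1, …` are corresponding orthonormal eigenvectors: no eigenvector
orthogonal to all the `psi k` belongs to an eigenvalue exceeding one of the `lam k`. -/
structure IsLeadingEigensystem {K : ℕ} (A : H →L[ℝ] H) (lam : Fin K → ℝ) (psi : Fin K → H) :
    Prop where
  orthonormal : Orthonormal ℝ psi
  eigen : ∀ k, A (psi k) = lam k • psi k
  antitone : Antitone lam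
  largest : ∀ (c : ℝ) (x : H), x ≠ 0 → A x = c • x → (∀ k, ⟪psi k, x⟫_ℝ = 0) → ∀ k, c ≤ lam k

/-- The statistic `T_HKR1 = ∑ₖ ⟪x̄ - ȳ, ψ̂ₖ⟫²`. -/
def THKR1 {m n L : ℕ} (psi : Fin L → H) (x : Fin m → H) (y : Fin n → H) : ℝ :=
  ∑ k, ⟪sampleMean x - sampleMean y, psi k⟫_ℝ ^ 2

/-- The statistic `T_HKR2 = ∑ₖ λ̂ₖ⁻¹ ⟪x̄ - ȳ, ψ̂ₖ⟫²`. -/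
def THKR2 {m n L : ℕ} (lam : Fin L → ℝ) (psi : Fin L → H) (x : Fin m → H) (y : Fin n → H) : ℝ :=
  ∑ k, (lam k)⁻¹ * ⟪sampleMean x - sampleMean y, psi k⟫_ℝ ^ 2

end Hilbert

/-- The noncentral chi-square law with one degree of freedom and noncentrality parameter `c ≥ 0`:
the law of `W²` for `W ~ N(√c, 1)`. -/
def noncentralChiSq (c : ℝ) : Measure ℝ :=
  (gaussianReal (√c) 1).map (fun w => w ^ 2)

instance (c : ℝ) : IsProbabilityMeasure (noncentralChiSq c) :=
  Measure.isProbabilityMeasure_map (by fun_prop)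

end TwoSample

end

noncomputable section

open scoped ENNReal NNReal

namespace TwoSample

/-! ### The type 2 inequality for weighted sums on a product space. -/

section TypeTwo

universe u

variable {E : Type u} [NormedAddCommGroup E] [NormedSpace ℝ E] [MeasurableSpace E]

/-! Put Z = √(mn/N) (Ȳ − X̄). The shift is scaled so that, for positive sample sizes, Z is exactly δ
plus a weighted sum of centred i.i.d. copies of X, with squared weights summing to 1 and maximal
weight tending to 0. All the statistics are read off from Z: (n/N) T_CFF is ‖Z‖², and the normalized
projection statistics are quadratic forms in Z with random coefficients.

Part (a) rests on a central limit theorem for such sums. Tightness is where type 2 enters: X is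
approximated in L² by a centred, finite-dimensional f(X), and the type 2 inequality controls the
sums of f(Xᵢ) and of Xᵢ − f(Xᵢ) uniformly in the weights (`isTightMeasureSet_weightedSumLaw`).
Characteristic functionals converge to Gaussian ones by replacing one factor at a time
(`tendsto_charFunDual_weightedSumLaw`). Prokhorov's theorem then produces the limit, so the
existence of G(δ, Σ) is a by-product, and continuous mapping gives ‖W‖².

For part (b), a Hilbert space is of type 2, so Z has the same Gaussian limit. The law of large
numbers for operator-valued variables makes the pooled covariance consistent in operator norm.
Weyl's inequality and the spectral gaps (`IsLeadingEigensystem.exists_perturbation_bound`) turn this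
into closeness of the eigenvalues and of the squares ⟨z, ψ̂ₖ⟩², which do not see the sign of ψ̂ₖ.
Hence each statistic is within η‖Z‖² of a fixed quadratic form in Z with probability tending to 1,
and the tightness of Z makes this negligible (`tendstoInDistribution_of_abs_sub_le_mul_norm_sq`).
Under the limit law the coordinates along the ψₖ are independent N(βₖ, λₖ), whose squares are λₖ
χ²₁(βₖ²/λₖ). -/

theorem IsTypeTwo.exists_integral_norm_sq_weightedSum_le [BorelSpace E] [SecondCountableTopology E]
    [CompleteSpace E] (hE : IsTypeTwo E) :
    ∃ b : ℝ, 0 < b ∧ ∀ (ι : Type) [Fintype ι] (μ : Measure E) [IsProbabilityMeasure μ]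
      (f : E → E), Measurable f → MemLp f 2 μ → ∫ x, f x ∂μ = 0 → ∀ c : ι → ℝ,
      ∫ x, ‖∑ i, c i • f (x i)‖ ^ 2 ∂(Measure.pi fun _ : ι => μ) ≤
        b * ((∑ i, c i ^ 2) * ∫ x, ‖f x‖ ^ 2 ∂μ) := by
  obtain ⟨b, hb, h⟩ := hE
  refine ⟨b, hb, fun ι _ μ _ f hf hf2 hf0 c => ?_⟩
  let e := Fintype.equivFin ι
  -- The product space `ι → E` lies in the universe of `E`, as `IsTypeTwo` requires; samples on
  -- arbitrary spaces are later compared with it through their joint law.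
  let P : Measure (ι → E) := Measure.pi fun _ : ι => μ
  have hev (i : ι) : MeasurePreserving (fun x : ι → E => x i) P μ :=
    measurePreserving_eval _ i
  have hindep : iIndepFun (fun (i : ι) (x : ι → E) => c i • f (x i)) P :=
    iIndepFun_pi (X := fun i x => c i • f x) (fun i => by fun_prop)
  have key := h (ι → E) P (Fintype.card ι) (fun i x => c (e.symm i) • f (x (e.symm i)))
    (fun i => by fun_prop) (hindep.precomp e.symm.injective)
    (fun i => (hf2.comp_measurePreserving (hev _)).const_smul _)
    (fun i => by
      rw [integral_smul]
      have := (hev (e.symm i)).map_eq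
      have h2 := integral_map (μ := P) (φ := fun x : ι → E => x (e.symm i)) (f := f)
        (measurable_pi_apply _).aemeasurable (by rw [this]; exact hf.aestronglyMeasurable)
      rw [← h2, this, hf0, smul_zero])
  have h1 (x : ι → E) : ∑ i, c (e.symm i) • f (x (e.symm i)) = ∑ i, c i • f (x i) :=
    e.symm.sum_comp (fun i => c i • f (x i))
  simp only [h1] at key
  refine key.trans (le_of_eq ?_)
  congr 1
  rw [Finset.sum_mul, ← e.symm.sum_comp (fun i => c i ^ 2 * _)]
  refine Finset.sum_congr rfl fun i _ => ?_
  have := (hev (e.symm i)).map_eq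
  have h2 := integral_map (μ := P) (φ := fun x : ι → E => x (e.symm i)) (f := fun y => ‖f y‖ ^ 2)
    (measurable_pi_apply _).aemeasurable
    (by rw [this]; exact (hf.norm.pow_const 2).aestronglyMeasurable)
  rw [this] at h2
  simp only [norm_smul, mul_pow, integral_const_mul, Real.norm_eq_abs, sq_abs]
  rw [h2]

end TypeTwo

/-! ### Tightness criteria and finite-dimensional approximation in L². -/

section Tight

variable {E : Type*} [NormedAddCommGroup E] [MeasurableSpace E]

/-- In a complete space, a set of measures is tight as soon as it is concentrated, up to `ε`, on
arbitrarily small neighbourhoods of compact sets. -/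
theorem isTightMeasureSet_of_forall_cthickening [CompleteSpace E] {S : Set (Measure E)}
    (h : ∀ ε : ℝ≥0∞, 0 < ε → ∀ r : ℝ, 0 < r →
      ∃ K : Set E, IsCompact K ∧ ∀ μ ∈ S, μ (Metric.cthickening r K)ᶜ ≤ ε) :
    IsTightMeasureSet S := by
  rw [isTightMeasureSet_iff_exists_isCompact_measure_compl_le]
  intro ε hε
  obtain ⟨u, hu0, hu⟩ := ENNReal.exists_pos_sum_of_countable' hε.ne' ℕ
  choose K hK hKS using fun k : ℕ => h (u k) (hu0 k) (1 / ((k : ℝ) + 1)) (by positivity)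
  -- Each thickened compact set has a finite net at a scale comparable to its thickness, so the
  -- closed intersection is totally bounded; the exceptional masses `u k` sum to less than `ε`.
  refine ⟨⋂ k : ℕ, Metric.cthickening (1 / ((k : ℝ) + 1)) (K k), ?_, fun μ hμ => ?_⟩
  · refine TotallyBounded.isCompact_of_isClosed ?_
      (isClosed_iInter fun k => Metric.isClosed_cthickening)
    rw [Metric.totallyBounded_iff]
    intro r hr
    obtain ⟨k, hk⟩ := exists_nat_one_div_lt (half_pos (half_pos hr))
    obtain ⟨t, ht, htK⟩ := Metric.totallyBounded_iff.1 (hK k).totallyBounded (r / 2) (half_pos hr)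
    refine ⟨t, ht, fun x hx => ?_⟩
    have hx' := Set.mem_iInter.1 hx k
    have hx2 : x ∈ Metric.thickening (r / 2) (K k) :=
      Metric.cthickening_subset_thickening' (half_pos hr) (by linarith) _ hx'
    obtain ⟨y, hy, hxy⟩ := Metric.mem_thickening_iff.1 hx2
    obtain ⟨z, hz, hyz⟩ := Set.mem_iUnion₂.1 (htK hy)
    refine Set.mem_iUnion₂.2 ⟨z, hz, ?_⟩
    rw [Metric.mem_ball] at hyz ⊢
    linarith [dist_triangle x y z]
  · rw [Set.compl_iInter]
    exact (measure_iUnion_le _).trans ((ENNReal.tsum_le_tsum fun k => hKS k μ hμ).trans hu.le)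

theorem measure_norm_ge_le {E : Type*} [NormedAddCommGroup E] {Ω : Type*} [MeasurableSpace Ω]
    {P : Measure Ω}
    {f : Ω → E} (hf : MemLp f 2 P) {C M : ℝ} (hM : 0 < M)
    (hC : ∫ ω, ‖f ω‖ ^ 2 ∂P ≤ C) :
    P {ω | M ≤ ‖f ω‖} ≤ ENNReal.ofReal (C / M ^ 2) := by
  have hint : Integrable (fun ω => ‖f ω‖ ^ 2) P := hf.integrable_norm_pow (by simp)
  have h := mul_meas_ge_le_lintegral₀ (μ := P) (f := fun ω => ENNReal.ofReal (‖f ω‖ ^ 2))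
    (hint.aestronglyMeasurable.aemeasurable.ennreal_ofReal) (ENNReal.ofReal (M ^ 2))
  rw [← ofReal_integral_eq_lintegral_ofReal hint (ae_of_all _ fun ω => by positivity)] at h
  rw [ENNReal.ofReal_div_of_pos (by positivity), ENNReal.le_div_iff_mul_le
    (Or.inl (by simpa using hM.ne')) (Or.inl (by simp)), mul_comm]
  refine (le_trans (mul_le_mul_right ?_ _) h).trans (ENNReal.ofReal_le_ofReal hC)
  refine measure_mono fun ω hω => ?_
  exact ENNReal.ofReal_le_ofReal (pow_le_pow_left₀ hM.le hω 2)

variable [NormedSpace ℝ E] [BorelSpace E] [CompleteSpace E]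

/-- A simple function is dense in L² and has finite-dimensional span. Recentring it, which the type
2 inequality needs, at most doubles the L² error. -/
theorem exists_finiteDimensional_approx {μ : Measure E} [IsProbabilityMeasure μ]
    (hμ : MemLp id 2 μ) (hμ0 : ∫ x, x ∂μ = 0) {η : ℝ} (hη : 0 < η) :
    ∃ (f : E → E) (F : Submodule ℝ E), FiniteDimensional ℝ F ∧ Measurable f ∧ MemLp f 2 μ ∧
      (∀ x, f x ∈ F) ∧ ∫ x, f x ∂μ = 0 ∧ ∫ x, ‖x - f x‖ ^ 2 ∂μ ≤ η := by
  obtain ⟨g, hg, hg2⟩ := hμ.exists_simpleFunc_eLpNorm_sub_lt (by simp)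
    (ε := ENNReal.ofReal (√η / 2)) (by simpa using hη)
  have hgint : Integrable g μ := hg2.integrable (by simp)
  have hid : Integrable (fun x : E => x) μ := hμ.integrable (by simp)
  let a := ∫ x, g x ∂μ
  let V : Submodule ℝ E := Submodule.span ℝ (insert a (Set.range g))
  have hVfin : FiniteDimensional ℝ V :=
    FiniteDimensional.span_of_finite ℝ ((SimpleFunc.finite_range g).insert a)
  have hsub2 : MemLp (fun x => x - g x) 2 μ := hμ.sub hg2
  refine ⟨fun x => g x - a, V, hVfin, by fun_prop, hg2.sub (memLp_const _),
    fun x => V.sub_mem (Submodule.subset_span (by simp)) (Submodule.subset_span (by simp)), ?_, ?_⟩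
  · rw [integral_sub hgint (integrable_const _)]; simp [a]
  -- As `μ` is centred, the mean of `g` is minus the mean of the error, so its norm is at most the
  -- L¹ norm, hence the L² norm, of the error.
  · have ha : a = - ∫ x, (x - g x) ∂μ := by
      rw [integral_sub hid hgint, hμ0]; simp [a]
    have hsum : eLpNorm (fun x => x - (g x - a)) 2 μ ≤ ENNReal.ofReal (√η) := by
      have h1 : eLpNorm (fun x => x - g x) 2 μ ≤ ENNReal.ofReal (√η / 2) := hg.le
      have h2 : eLpNorm (fun _ : E => a) 2 μ ≤ ENNReal.ofReal (√η / 2) := by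
        rw [eLpNorm_const _ (by simp) (IsProbabilityMeasure.ne_zero μ)]
        simp only [measure_univ, ENNReal.one_rpow, mul_one]
        refine le_trans ?_ h1
        rw [ha, enorm_neg]
        refine (enorm_integral_le_lintegral_enorm _).trans ?_
        rw [← eLpNorm_one_eq_lintegral_enorm]
        exact eLpNorm_le_eLpNorm_of_exponent_le (by simp) hsub2.aestronglyMeasurable
      have : (fun x => x - (g x - a)) = (fun x => x - g x) + fun _ : E => a := by
        ext x; simp; abel
      rw [this]
      refine (eLpNorm_add_le hsub2.aestronglyMeasurable aestronglyMeasurable_const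
        (by simp)).trans ((add_le_add h1 h2).trans ?_)
      rw [← ENNReal.ofReal_add (by positivity) (by positivity), add_halves]
    have hm : MemLp (fun x => x - (g x - a)) 2 μ := hμ.sub (hg2.sub (memLp_const _))
    have h3 := hm.eLpNorm_eq_integral_rpow_norm (by simp) (by simp)
    rw [h3] at hsum
    rw [ENNReal.ofReal_le_ofReal_iff (by positivity)] at hsum
    simp only [ENNReal.toReal_ofNat, Real.rpow_ofNat] at hsum
    rw [← one_div, ← Real.sqrt_eq_rpow] at hsum
    exact (Real.sqrt_le_sqrt_iff hη.le).1 hsum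

end Tight

/-! ### Uniform tightness of weighted sums. -/

section WeightedSum

universe u

variable {E : Type u} [NormedAddCommGroup E] [NormedSpace ℝ E] [MeasurableSpace E] [BorelSpace E]
  [SecondCountableTopology E] [CompleteSpace E]

/-- The law of `∑ i, c i • Xᵢ` for independent `Xᵢ` with law `μ`. -/
def weightedSumLaw {ι : Type} [Fintype ι] (μ : Measure E) (c : ι → ℝ) : Measure E :=
  (Measure.pi fun _ : ι => μ).map (fun x => ∑ i, c i • x i)

instance {ι : Type} [Fintype ι] (μ : Measure E) [IsProbabilityMeasure μ] (c : ι → ℝ) :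
    IsProbabilityMeasure (weightedSumLaw μ c) :=
  Measure.isProbabilityMeasure_map (Measurable.aemeasurable (by fun_prop))

/-- Split each summand as f(Xᵢ) + (Xᵢ − f(Xᵢ)) with f centred and finite-dimensional. By type 2 and
Chebyshev, the first sum stays in a fixed ball of the finite-dimensional space and the second is
small, with bounds that do not depend on the weights. -/
theorem isTightMeasureSet_weightedSumLaw (hE : IsTypeTwo E) {μ : Measure E}
    [IsProbabilityMeasure μ] (hμ : MemLp id 2 μ) (hμ0 : ∫ x, x ∂μ = 0) :
    IsTightMeasureSet {ν : Measure E | ∃ (ι : Type) (_ : Fintype ι) (c : ι → ℝ),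
      ∑ i, c i ^ 2 ≤ 1 ∧ ν = weightedSumLaw μ c} := by
  obtain ⟨b, hb, hbE⟩ := hE.exists_integral_norm_sq_weightedSum_le
  refine isTightMeasureSet_of_forall_cthickening fun ε hε r hr => ?_
  obtain ⟨e, he0, heε⟩ : ∃ e : ℝ, 0 < e ∧ ENNReal.ofReal e ≤ ε := by
    obtain ⟨e, he0, he⟩ := ENNReal.lt_iff_exists_nnreal_btwn.1 hε
    exact ⟨e, by exact_mod_cast he0, by simpa using he.le⟩
  -- This accuracy makes the Chebyshev bound b·η/r² for the remainder equal to e/2.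
  obtain ⟨f, F, hF, hfm, hf2, hfF, hf0, hfη⟩ := exists_finiteDimensional_approx hμ hμ0
    (η := e / 2 * r ^ 2 / b) (by positivity)
  have hid : Integrable (fun x : E => x) μ := hμ.integrable (by simp)
  let A := b * ∫ x, ‖f x‖ ^ 2 ∂μ
  have hA : 0 ≤ A := by positivity
  obtain ⟨M, hM0, hM⟩ : ∃ M : ℝ, 0 < M ∧ A / M ^ 2 ≤ e / 2 := by
    -- The summand 1 keeps the radius positive when `A` vanishes.
    refine ⟨√(A / (e / 2) + 1), by positivity, ?_⟩
    rw [Real.sq_sqrt (by positivity), div_le_iff₀ (by positivity)]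
    have : e / 2 * (A / (e / 2) + 1) = A + e / 2 := by field_simp
    linarith
  refine ⟨(F : Set E) ∩ Metric.closedBall 0 M, ?_, ?_⟩
  · have : ((↑) : F → E) '' Metric.closedBall 0 M = (F : Set E) ∩ Metric.closedBall 0 M := by
      ext x
      simp only [Set.mem_image, Metric.mem_closedBall, dist_zero_right, Set.mem_inter_iff,
        SetLike.mem_coe]
      constructor
      · rintro ⟨y, hy, rfl⟩; exact ⟨y.2, hy⟩
      · rintro ⟨h1, h2⟩; exact ⟨⟨x, h1⟩, h2, rfl⟩
    rw [← this]
    have := FiniteDimensional.proper_real F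
    exact (isCompact_closedBall _ _).image continuous_subtype_val
  rintro ν ⟨ι, _, c, hc, rfl⟩
  rw [weightedSumLaw,
    Measure.map_apply (by fun_prop) Metric.isClosed_cthickening.measurableSet.compl]
  set Q : Measure (ι → E) := Measure.pi fun _ : ι => μ
  have hev (i : ι) : MeasurePreserving (fun x : ι → E => x i) Q μ :=
    measurePreserving_eval _ i
  have hL2 {g : E → E} (hg : MemLp g 2 μ) : MemLp (fun x : ι → E => ∑ i, c i • g (x i)) 2 Q :=
    memLp_finsetSum _ fun i _ => (hg.comp_measurePreserving (hev i)).const_smul (c i)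
  have hbound {g : E → E} (hgm : Measurable g) (hg : MemLp g 2 μ) (hg0 : ∫ x, g x ∂μ = 0) :
      ∫ x, ‖∑ i, c i • g (x i)‖ ^ 2 ∂Q ≤ b * ∫ x, ‖g x‖ ^ 2 ∂μ := by
    refine (hbE ι μ g hgm hg hg0 c).trans ?_
    gcongr
    exact mul_le_of_le_one_left (by positivity) hc
  have hr2 : MemLp (fun x => x - f x) 2 μ := hμ.sub hf2
  have hr0 : ∫ x, (x - f x) ∂μ = 0 := by
    rw [integral_sub hid (hf2.integrable (by simp)), hμ0, hf0, sub_zero]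
  have h1 := measure_norm_ge_le (hL2 hf2) hM0 (hbound hfm hf2 hf0)
  have h2 := measure_norm_ge_le (hL2 hr2) hr (hbound (by fun_prop) hr2 hr0)
  have h3 : b * ∫ x, ‖x - f x‖ ^ 2 ∂μ ≤ e / 2 * r ^ 2 := by
    calc _ ≤ b * (e / 2 * r ^ 2 / b) := by gcongr
      _ = _ := by field_simp
  refine le_trans (measure_mono ?_) ((measure_union_le _ _).trans
    ((add_le_add (h1.trans (ENNReal.ofReal_le_ofReal hM))
    (h2.trans (ENNReal.ofReal_le_ofReal (?_ : _ ≤ e / 2)))).trans ?_))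
  · intro x hx
    by_contra hcon
    simp only [Set.mem_union, Set.mem_ofPred_eq, not_or, not_le] at hcon
    apply hx
    refine Metric.mem_cthickening_of_dist_le _ (∑ i, c i • f (x i)) _ _ ⟨?_, ?_⟩ ?_
    · exact F.sum_mem fun i _ => F.smul_mem _ (hfF _)
    · simpa using hcon.1.le
    · rw [dist_eq_norm, ← Finset.sum_sub_distrib]
      simpa [smul_sub] using hcon.2.le
  · rw [div_le_iff₀ (by positivity)]; exact h3
  · rw [← ENNReal.ofReal_add (by positivity) (by positivity), add_halves]; exact heε

end WeightedSum

/-! ### Convergence of characteristic functionals. -/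

section CharFun

/-- Factors are exchanged one at a time; the remaining ones have modulus at most 1. -/
theorem norm_prod_sub_prod_le {ι : Type*} (s : Finset ι) (a b : ι → ℂ)
    (ha : ∀ i ∈ s, ‖a i‖ ≤ 1) (hb : ∀ i ∈ s, ‖b i‖ ≤ 1) :
    ‖∏ i ∈ s, a i - ∏ i ∈ s, b i‖ ≤ ∑ i ∈ s, ‖a i - b i‖ := by
  classical
  induction s using Finset.induction_on with
  | empty => simp
  | insert i s hi ih =>
    have ih' := ih (fun j hj => ha j (Finset.mem_insert_of_mem hj))
      (fun j hj => hb j (Finset.mem_insert_of_mem hj))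
    rw [Finset.prod_insert hi, Finset.prod_insert hi, Finset.sum_insert hi]
    have h1 : a i * ∏ j ∈ s, a j - b i * ∏ j ∈ s, b j =
        (a i - b i) * ∏ j ∈ s, a j + b i * (∏ j ∈ s, a j - ∏ j ∈ s, b j) := by ring
    have h2 : ‖∏ j ∈ s, a j‖ ≤ 1 := by
      rw [norm_prod]
      exact Finset.prod_le_one (fun _ _ => norm_nonneg _)
        (fun j hj => ha j (Finset.mem_insert_of_mem hj))
    rw [h1]
    refine (norm_add_le _ _).trans (add_le_add ?_ ?_)
    · rw [norm_mul]; exact mul_le_of_le_one_right (norm_nonneg _) h2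
    · rw [norm_mul]
      exact (mul_le_of_le_one_left (norm_nonneg _) (hb i (Finset.mem_insert_self _ _))).trans ih'

/-- Both functions have the expansion 1 − v t²/2 + o(t²) at the origin. -/
theorem charFun_sub_exp_isLittleO {ν : Measure ℝ} [IsProbabilityMeasure ν] (hν : MemLp id 2 ν)
    (h0 : ∫ x, x ∂ν = 0) :
    (fun t : ℝ => charFun ν t - Complex.exp (-(t ^ 2 * ∫ x, x ^ 2 ∂ν : ℝ) / 2)) =o[𝓝 0]
      fun t : ℝ => t ^ 2 := by
  set v : ℝ := ∫ x, x ^ 2 ∂ν with hv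
  have h1 : (fun t : ℝ => charFun ν t - (1 - (v * t ^ 2 / 2 : ℝ))) =o[𝓝 0]
      fun t : ℝ => t ^ 2 := by
    have h := taylor_isLittleO_univ (n := 2) (x₀ := 0) (f := charFun ν)
      (contDiff_charFun (n := 2) hν)
    have hmap : ν.map id = ν := Measure.map_id
    have h2 := taylorWithinEval_charFun_two_zero (P := ν) (X := id) aemeasurable_id
      (by rwa [hmap])
    rw [hmap] at h2
    simp only [h2, sub_zero] at h
    refine h.congr_left fun t => ?_
    simp [h0, hv]
  have h2 : (fun t : ℝ => Complex.exp (-(t ^ 2 * v : ℝ) / 2) - (1 - (v * t ^ 2 / 2 : ℝ))) =o[𝓝 0]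
      fun t : ℝ => t ^ 2 := by
    have hE : (fun z : ℂ => Complex.exp z - 1 - z) =o[𝓝 0] fun z : ℂ => z := by
      have := (Complex.hasDerivAt_exp 0).isLittleO
      simpa using this
    have ht : Tendsto (fun t : ℝ => (-(t ^ 2 * v : ℝ) / 2 : ℂ)) (𝓝 0) (𝓝 0) := by
      have : Continuous (fun t : ℝ => (-(t ^ 2 * v : ℝ) / 2 : ℂ)) := by fun_prop
      simpa using this.tendsto 0
    have hO : ((fun z : ℂ => z) ∘ fun t : ℝ => (-(t ^ 2 * v : ℝ) / 2 : ℂ)) =O[𝓝 0]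
        fun t : ℝ => t ^ 2 := by
      refine Asymptotics.IsBigO.of_bound (|v| / 2) (Eventually.of_forall fun t => ?_)
      simp only [Function.comp_apply]
      rw [norm_div, norm_neg, Complex.norm_real, norm_mul, Real.norm_eq_abs v]
      simp; linarith
    refine ((hE.comp_tendsto ht).trans_isBigO hO).congr_left fun t => ?_
    simp only [Function.comp_apply]; push_cast; ring
  refine (h1.sub h2).congr_left fun t => ?_
  ring

variable {E : Type*} [NormedAddCommGroup E] [NormedSpace ℝ E] [MeasurableSpace E] [BorelSpace E]
  [SecondCountableTopology E]

theorem charFunDual_weightedSumLaw {ι : Type} [Fintype ι] (μ : Measure E)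
    [IsProbabilityMeasure μ] (c : ι → ℝ) (ℓ : StrongDual ℝ E) :
    charFunDual (weightedSumLaw μ c) ℓ = ∏ i, charFunDual μ (c i • ℓ) := by
  simp only [charFunDual_apply]
  rw [weightedSumLaw, integral_map (Measurable.aemeasurable (by fun_prop))
    (by fun_prop)]
  rw [← integral_fintype_prod_eq_prod (μ := fun _ : ι => μ)
    (fun i x => Complex.exp (((c i • ℓ) x : ℝ) * Complex.I))]
  congr with x
  rw [← Complex.exp_sum, ← Finset.sum_mul]
  simp

variable [CompleteSpace E]

/-- Replacing each factor by its Gaussian counterpart costs at most (ε/2) cᵢ² once all weights are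
small, and these costs add up to ε/2. -/
theorem tendsto_charFunDual_weightedSumLaw {μ : Measure E} [IsProbabilityMeasure μ]
    (hμ : MemLp id 2 μ) (hμ0 : ∫ x, x ∂μ = 0) {ι : ℕ → Type} [∀ j, Fintype (ι j)]
    {c : ∀ j, ι j → ℝ} (hc : ∀ᶠ j in atTop, ∑ i, c j i ^ 2 = 1)
    (hmax : ∀ ε > 0, ∀ᶠ j in atTop, ∀ i, |c j i| ≤ ε) (ℓ : StrongDual ℝ E) :
    Tendsto (fun j => charFunDual (weightedSumLaw μ (c j)) ℓ) atTop
      (𝓝 (Complex.exp (-covarianceBilinDual μ ℓ ℓ / 2))) := by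
  set v := covarianceBilinDual μ ℓ ℓ with hv
  have hℓ0 : ∫ x, ℓ x ∂μ = 0 := by
    rw [ℓ.integral_comp_comm (φ := fun x => x) (hμ.integrable (by simp)), hμ0, map_zero]
  have hv2 : v = ∫ x, x ^ 2 ∂(μ.map ℓ) := by
    rw [hv, covarianceBilinDual_apply hμ, integral_map (by fun_prop) (by fun_prop)]
    simp [hℓ0, pow_two]
  have : IsProbabilityMeasure (μ.map ℓ) := Measure.isProbabilityMeasure_map (by fun_prop)
  have hlit := charFun_sub_exp_isLittleO (ν := μ.map ℓ)
    ((memLp_map_measure_iff (by fun_prop) (by fun_prop)).2 (ℓ.comp_memLp' hμ))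
    (by rw [integral_map (by fun_prop) (by fun_prop)]; exact hℓ0)
  rw [← hv2] at hlit
  simp only [charFun_map_eq_charFunDual_smul] at hlit
  have hv0 : 0 ≤ v := covarianceBilinDual_self_nonneg ℓ
  rw [Metric.tendsto_nhds]
  intro ε hε
  have h1 := hlit.bound (half_pos hε)
  obtain ⟨r, hr, hball⟩ := Metric.eventually_nhds_iff.1 h1
  filter_upwards [hc, hmax (r / 2) (half_pos hr)] with j hj hjm
  -- The Gaussian limit is split over the summands, using that the squared weights sum to 1.
  have hprod : Complex.exp (-v / 2) = ∏ i, Complex.exp (-(c j i ^ 2 * v : ℝ) / 2) := by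
    rw [← Complex.exp_sum]
    congr 1
    rw [← Finset.sum_div, Finset.sum_neg_distrib]
    congr 2
    rw [← Complex.ofReal_sum, ← Finset.sum_mul, hj, one_mul]
  rw [charFunDual_weightedSumLaw, dist_eq_norm, hprod]
  refine (norm_prod_sub_prod_le _ _ _ (fun i _ => ?_) (fun i _ => ?_)).trans_lt ?_
  · rw [← charFun_map_eq_charFunDual_smul]
    exact norm_charFun_le_one _
  · rw [Complex.norm_exp, Real.exp_le_one_iff]
    have : (-(c j i ^ 2 * v : ℝ) / 2 : ℂ) = ((-(c j i ^ 2 * v) / 2 : ℝ) : ℂ) := by push_cast; ring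
    rw [this, Complex.ofReal_re]
    have := mul_nonneg (sq_nonneg (c j i)) hv0
    linarith
  · refine (Finset.sum_le_sum (g := fun i => ε / 2 * c j i ^ 2) fun i _ => ?_).trans_lt ?_
    · have := hball (y := c j i) (by rw [Real.dist_eq, sub_zero]; linarith [hjm i])
      simpa using this
    · rw [← Finset.mul_sum, hj]; linarith

/-- A tight sequence of laws whose characteristic functions converge is weakly convergent. -/
theorem exists_tendsto_of_isTight_of_tendsto_charFunDual {μ : ℕ → ProbabilityMeasure E}
    (ht : IsTightMeasureSet {((μ j : ProbabilityMeasure E) : Measure E) | j})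
    {Φ : StrongDual ℝ E → ℂ}
    (h : ∀ ℓ, Tendsto (fun j => charFunDual (μ j : Measure E) ℓ) atTop (𝓝 (Φ ℓ))) :
    ∃ G : ProbabilityMeasure E, Tendsto μ atTop (𝓝 G) ∧
      ∀ ℓ, charFunDual (G : Measure E) ℓ = Φ ℓ := by
  have hcpt : IsCompact (closure {μ j | j}) :=
    isCompact_closure_of_isTightMeasureSet (by simpa using ht)
  -- Prokhorov gives a limit along every ultrafilter; its characteristic functional is `Φ`, so all
  -- these limits coincide.
  have key (U : Ultrafilter ℕ) (hU : (U : Filter ℕ) ≤ atTop) :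
      ∃ G : ProbabilityMeasure E, Tendsto μ U (𝓝 G) ∧
        ∀ ℓ, charFunDual (G : Measure E) ℓ = Φ ℓ := by
    obtain ⟨G, -, hG : Tendsto _ _ _⟩ := hcpt.ultrafilter_le_nhds (U.map μ)
      (.trans (by simp) (monotone_principal subset_closure))
    refine ⟨G, hG, fun ℓ => tendsto_nhds_unique ?_ ((h ℓ).mono_left hU)⟩
    exact (ProbabilityMeasure.tendsto_iff_forall_integral_rclike_tendsto ℂ).1 hG
      (BoundedContinuousFunction.probCharDual ℓ)
  obtain ⟨G, -, hG⟩ := key (Ultrafilter.of atTop) (Ultrafilter.of_le _)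
  refine ⟨G, (tendsto_iff_ultrafilter _ _ _).2 fun U hU => ?_, hG⟩
  obtain ⟨G', hG', hG'2⟩ := key U hU
  have hGG : (G' : Measure E) = (G : Measure E) :=
    Measure.ext_of_charFunDual (funext fun ℓ => (hG'2 ℓ).trans (hG ℓ).symm)
  have : G' = G := Subtype.ext hGG
  exact this ▸ hG'

end CharFun

/-! ### The central limit theorem in type 2 spaces. -/

section CLT

universe u

variable {E : Type u} [NormedAddCommGroup E] [NormedSpace ℝ E] [MeasurableSpace E] [BorelSpace E]
  [SecondCountableTopology E] [CompleteSpace E]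

/-- The central limit theorem for weighted sums in a space of type 2. -/
theorem exists_isGaussian_tendsto_weightedSumLaw (hE : IsTypeTwo E) {μ : Measure E}
    [IsProbabilityMeasure μ] (hμ : MemLp id 2 μ) (hμ0 : ∫ x, x ∂μ = 0)
    {ι : ℕ → Type} [∀ j, Fintype (ι j)] {c : ∀ j, ι j → ℝ} (hc1 : ∀ j, ∑ i, c j i ^ 2 ≤ 1)
    (hc : ∀ᶠ j in atTop, ∑ i, c j i ^ 2 = 1)
    (hmax : ∀ ε > 0, ∀ᶠ j in atTop, ∀ i, |c j i| ≤ ε) :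
    ∃ G : ProbabilityMeasure E,
      Tendsto (β := ProbabilityMeasure E) (fun j => ⟨weightedSumLaw μ (c j), inferInstance⟩) atTop
        (𝓝 G) ∧
      ∀ ℓ, charFunDual (G : Measure E) ℓ = Complex.exp (-covarianceBilinDual μ ℓ ℓ / 2) := by
  refine exists_tendsto_of_isTight_of_tendsto_charFunDual
    ((isTightMeasureSet_weightedSumLaw hE hμ hμ0).subset ?_)
    (tendsto_charFunDual_weightedSumLaw hμ hμ0 hc hmax)
  rintro _ ⟨j, rfl⟩
  exact ⟨ι j, inferInstance, c j, hc1 j, rfl⟩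

end CLT

/-! ### The standardized mean difference as a weighted sum. -/

section Sample

variable {E : Type*} [NormedAddCommGroup E] [NormedSpace ℝ E] [MeasurableSpace E] [BorelSpace E]
  [SecondCountableTopology E]

/-- The two samples, with the constant `a` subtracted from the first one and `a + Δ` from the
second one. -/
def centeredSample {Ω : Type*} (a Δ : E) {m n : ℕ} (X : Fin m → Ω → E) (Y : Fin n → Ω → E) :
    Fin m ⊕ Fin n → Ω → E :=
  Sum.elim (fun i ω => X i ω - a) (fun j ω => Y j ω - Δ - a)

namespace IsShiftedTwoSample

variable {Ω : Type*} [MeasurableSpace Ω] {P : Measure Ω} {μ : Measure E} {Δ : E} {m n : ℕ}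
  {X : Fin m → Ω → E} {Y : Fin n → Ω → E}

omit [NormedSpace ℝ E] [SecondCountableTopology E] in
theorem iIndepFun_centeredSample (h : IsShiftedTwoSample P μ Δ X Y) (a : E) :
    iIndepFun (centeredSample a Δ X Y) P := by
  have := h.indep.comp (fun s : Fin m ⊕ Fin n => (Sum.elim (fun _ x => x - a)
    (fun _ x => x - Δ - a) s : E → E))
    (by rintro (i | i) <;> simp only [Sum.elim_inl, Sum.elim_inr] <;> fun_prop)
  convert this using 1
  ext s ω
  rcases s with s | s <;> rfl

omit [NormedSpace ℝ E] [SecondCountableTopology E] in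
theorem hasLaw_centeredSample (h : IsShiftedTwoSample P μ Δ X Y) (a : E) (s : Fin m ⊕ Fin n) :
    HasLaw (centeredSample a Δ X Y s) (μ.map (fun x => x - a)) P := by
  rcases s with i | i
  · refine ⟨(h.law_X i).aemeasurable.sub_const a, ?_⟩
    have : centeredSample a Δ X Y (Sum.inl i) = (fun x => x - a) ∘ X i := rfl
    rw [this, ← AEMeasurable.map_map_of_aemeasurable (by fun_prop) (h.law_X i).aemeasurable,
      (h.law_X i).map_eq]
  · refine ⟨((h.law_Y i).aemeasurable.sub_const Δ).sub_const a, ?_⟩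
    have : centeredSample a Δ X Y (Sum.inr i) = (fun x => x - Δ - a) ∘ Y i := rfl
    rw [this, ← AEMeasurable.map_map_of_aemeasurable (by fun_prop) (h.law_Y i).aemeasurable,
      (h.law_Y i).map_eq, Measure.map_map (by fun_prop) (by fun_prop)]
    congr 1
    ext x
    simp

omit [NormedSpace ℝ E] [SecondCountableTopology E] in
theorem map_centeredSample [IsProbabilityMeasure P] (h : IsShiftedTwoSample P μ Δ X Y) (a : E) :
    P.map (fun ω s => centeredSample a Δ X Y s ω) =
      Measure.pi fun _ : Fin m ⊕ Fin n => μ.map (fun x => x - a) := by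
  rw [(iIndepFun_iff_map_fun_eq_pi_map
    fun s => (h.hasLaw_centeredSample a s).aemeasurable).1 (h.iIndepFun_centeredSample a)]
  congr with s : 1
  exact (h.hasLaw_centeredSample a s).map_eq

end IsShiftedTwoSample

/-- The coefficients of the standardized difference of the sample means. -/
def meanDiffWeight (m n : ℕ) : Fin m ⊕ Fin n → ℝ :=
  Sum.elim (fun _ => -(√((m : ℝ) * n / (m + n)) / m)) (fun _ => √((m : ℝ) * n / (m + n)) / n)

/-- With an empty sample all weights vanish. Covering this case puts every term of the sequence, not
only the late ones, in the tight family. -/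
theorem sum_sq_meanDiffWeight_le (m n : ℕ) : ∑ s, meanDiffWeight m n s ^ 2 ≤ 1 := by
  simp only [meanDiffWeight, Fintype.sum_sum_type, Sum.elim_inl, Sum.elim_inr, Finset.sum_const,
    Finset.card_univ, Fintype.card_fin, nsmul_eq_mul, neg_sq, div_pow]
  rw [Real.sq_sqrt (by positivity)]
  rcases Nat.eq_zero_or_pos m with rfl | hm
  · simp
  rcases Nat.eq_zero_or_pos n with rfl | hn
  · simp
  have hm' : (0 : ℝ) < m := by exact_mod_cast hm
  have hn' : (0 : ℝ) < n := by exact_mod_cast hn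
  apply le_of_eq
  field_simp
  ring

theorem sum_sq_meanDiffWeight {m n : ℕ} (hm : 0 < m) (hn : 0 < n) :
    ∑ s, meanDiffWeight m n s ^ 2 = 1 := by
  simp only [meanDiffWeight, Fintype.sum_sum_type, Sum.elim_inl, Sum.elim_inr, Finset.sum_const,
    Finset.card_univ, Fintype.card_fin, nsmul_eq_mul, neg_sq, div_pow]
  rw [Real.sq_sqrt (by positivity)]
  have hm' : (0 : ℝ) < m := by exact_mod_cast hm
  have hn' : (0 : ℝ) < n := by exact_mod_cast hn
  field_simp
  ring

theorem abs_meanDiffWeight_le {m n k : ℕ} (hk : 0 < k) (hm : k ≤ m) (hn : k ≤ n)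
    (s : Fin m ⊕ Fin n) : |meanDiffWeight m n s| ≤ 1 / √k := by
  have hk' : (0 : ℝ) < k := by exact_mod_cast hk
  have hm' : (k : ℝ) ≤ m := by exact_mod_cast hm
  have hn' : (k : ℝ) ≤ n := by exact_mod_cast hn
  have hm0 := hk'.trans_le hm'
  have hn0 := hk'.trans_le hn'
  have key {x : ℝ} (hx : x ^ 2 ≤ 1 / k) : |x| ≤ 1 / √k := by
    refine abs_le_of_sq_le_sq ?_ (by positivity)
    rwa [div_pow, Real.sq_sqrt hk'.le, one_pow]
  refine key ?_
  rcases s with s | s <;>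
    simp only [meanDiffWeight, Sum.elim_inl, Sum.elim_inr, neg_sq, div_pow] <;>
    rw [Real.sq_sqrt (by positivity), div_div, div_le_div_iff₀ (by positivity) (by positivity),
      one_mul]
  · have : (m : ℝ) * n * k ≤ m * n * m := by gcongr
    nlinarith [mul_pos hm0 (mul_pos hm0 hm0)]
  · have : (m : ℝ) * n * k ≤ m * n * n := by gcongr
    nlinarith [mul_pos hn0 (mul_pos hn0 hn0)]

/-- The standardized difference of the sample means. -/
def meanDiff {m n : ℕ} (x : Fin m → E) (y : Fin n → E) : E :=
  √((m : ℝ) * n / (m + n)) • (sampleMean y - sampleMean x)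

omit [MeasurableSpace E] [BorelSpace E] [SecondCountableTopology E] in
-- The standardizing factor is the inverse of the factor in the shrinking shift, so the shift
-- contributes exactly δ, while the common centring `a` cancels.
theorem meanDiff_eq_add_sum {Ω : Type*} (a δ : E) {m n : ℕ} (hm : 0 < m) (hn : 0 < n)
    (X : Fin m → Ω → E) (Y : Fin n → Ω → E) (ω : Ω) :
    meanDiff (fun i => X i ω) (fun i => Y i ω) = δ + ∑ s, meanDiffWeight m n s •
      centeredSample a (shrinkingShift δ m n) X Y s ω := by
  have hm' : (0 : ℝ) < m := by exact_mod_cast hm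
  have hn' : (0 : ℝ) < n := by exact_mod_cast hn
  have hr : 0 < √((m : ℝ) * n / (m + n)) := by positivity
  simp only [meanDiff, meanDiffWeight, centeredSample, sampleMean, Fintype.sum_sum_type,
    Sum.elim_inl, Sum.elim_inr, ← Finset.smul_sum, Finset.sum_sub_distrib, Finset.sum_const,
    Finset.card_univ, Fintype.card_fin, shrinkingShift]
  simp only [← Nat.cast_smul_eq_nsmul ℝ, smul_sub, smul_smul]
  generalize √((m : ℝ) * n / (m + n)) = r at hr ⊢
  have e1 : r / n * (r⁻¹ * n) = 1 := by field_simp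
  have e2 : r / n * n = r := by field_simp
  have e3 : -(r / m) * m = -r := by field_simp
  rw [e1, e2, e3, one_smul, neg_smul, neg_smul, div_eq_mul_inv,
    div_eq_mul_inv]
  abel

end Sample

/-! ### Weak convergence of the mean difference, and part (a). -/

section Weak

/-- Convergence in distribution only depends on the laws, and only eventually. -/
theorem tendstoInDistribution_of_eventually_map_eq {E : Type*} [TopologicalSpace E]
    [MeasurableSpace E] [OpensMeasurableSpace E] {Ω : ℕ → Type*} [∀ j, MeasurableSpace (Ω j)]
    {P : ∀ j, Measure (Ω j)} [∀ j, IsProbabilityMeasure (P j)] {X : ∀ j, Ω j → E}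
    (hX : ∀ j, AEMeasurable (X j) (P j))
    {Ω' : Type*} [MeasurableSpace Ω'] {P' : Measure Ω'} [IsProbabilityMeasure P'] {Z : Ω' → E}
    (hZ : AEMeasurable Z P') {ν : ℕ → ProbabilityMeasure E} {G : ProbabilityMeasure E}
    (hν : Tendsto ν atTop (𝓝 G)) (h : ∀ᶠ j in atTop, (P j).map (X j) = ν j)
    (hG : P'.map Z = G) : TendstoInDistribution X atTop Z P P' where
  forall_aemeasurable := hX
  aemeasurable_limit := hZ
  tendsto := by
    have h1 : (⟨P'.map Z, Measure.isProbabilityMeasure_map hZ⟩ : ProbabilityMeasure E) = G :=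
      Subtype.ext hG
    rw [h1]
    refine hν.congr' (h.mono fun j hj => ?_)
    exact Subtype.ext hj.symm

variable {E : Type*} [NormedAddCommGroup E] [NormedSpace ℝ E] [MeasurableSpace E] [BorelSpace E]
  [SecondCountableTopology E] [CompleteSpace E]

omit [SecondCountableTopology E] in
theorem integral_map_sub_integral {μ : Measure E} [IsProbabilityMeasure μ]
    (hμ : MemLp id 2 μ) : ∫ x, x ∂(μ.map (fun x => x - ∫ y, y ∂μ)) = 0 := by
  have hid : Integrable (fun x : E => x) μ := hμ.integrable (by simp)
  rw [(measurableEmbedding_subRight _).integral_map, integral_sub hid (integrable_const _)]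
  simp

omit [SecondCountableTopology E] in
theorem covarianceBilinDual_map_sub_integral (μ : Measure E) [IsProbabilityMeasure μ]
    (hμ : MemLp id 2 μ) :
    covarianceBilinDual (μ.map (fun x => x - ∫ y, y ∂μ)) = covarianceBilinDual μ := by
  rw [covarianceBilinDual, integral_map_sub_integral hμ]
  simp [covarianceBilinDual]

/-- The weighted central limit theorem for the centred law, translated by δ; the mean and covariance
of the limit are read off from its characteristic functional. -/
theorem exists_isGaussian_tendstoInDistribution_meanDiff (hE : IsTypeTwo E)
    {m n : ℕ → ℕ} (hm : Tendsto m atTop atTop) (hn : Tendsto n atTop atTop)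
    {Ω : ℕ → Type*} [∀ j, MeasurableSpace (Ω j)]
    {P : ∀ j, Measure (Ω j)} [∀ j, IsProbabilityMeasure (P j)]
    {μ : Measure E} [IsProbabilityMeasure μ] {δ : E}
    {X : ∀ j, Fin (m j) → Ω j → E} {Y : ∀ j, Fin (n j) → Ω j → E}
    (h : ∀ j, IsShiftedTwoSample (P j) μ (shrinkingShift δ (m j) (n j)) (X j) (Y j))
    (hμ : MemLp id 2 μ) :
    ∃ (G : Measure E) (_ : IsGaussian G),
      ∫ x, x ∂G = δ ∧ covarianceBilinDual G = covarianceBilinDual μ ∧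
      TendstoInDistribution (fun j ω => meanDiff (fun i => X j i ω) (fun i => Y j i ω))
        atTop (id : E → E) P G := by
  set a : E := ∫ x, x ∂μ with ha
  set μ₀ := μ.map (fun x => x - a) with hμ₀
  have : IsProbabilityMeasure μ₀ := Measure.isProbabilityMeasure_map (by fun_prop)
  have hμ₀2 : MemLp id 2 μ₀ :=
    (memLp_map_measure_iff (by fun_prop) (by fun_prop)).2 (hμ.sub (memLp_const a))
  have hμ₀0 : ∫ x, x ∂μ₀ = 0 := integral_map_sub_integral hμ
  have hcov : covarianceBilinDual μ₀ = covarianceBilinDual μ :=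
    covarianceBilinDual_map_sub_integral μ hμ
  have hpos : ∀ᶠ j in atTop, 0 < m j ∧ 0 < n j :=
    (hm.eventually_gt_atTop 0).and (hn.eventually_gt_atTop 0)
  obtain ⟨G₀, hG₀, hG₀L⟩ := exists_isGaussian_tendsto_weightedSumLaw hE hμ₀2 hμ₀0
    (c := fun j => meanDiffWeight (m j) (n j)) (fun j => sum_sq_meanDiffWeight_le _ _)
    (hpos.mono fun j hj => sum_sq_meanDiffWeight hj.1 hj.2)
    (fun ε hε => by
      -- Once both samples have size at least `k`, the weights are at most 1/√k, hence at most `ε`.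
      obtain ⟨k, hk⟩ := exists_nat_gt (1 / ε ^ 2)
      have hk0 : (0 : ℝ) < k := lt_of_le_of_lt (by positivity) hk
      filter_upwards [hm.eventually_ge_atTop k, hn.eventually_ge_atTop k] with j h1 h2 s
      refine (abs_meanDiffWeight_le (by exact_mod_cast hk0) h1 h2 s).trans ?_
      rw [div_le_iff₀ (by positivity), ← div_le_iff₀' hε]
      refine Real.le_sqrt_of_sq_le ?_
      rw [div_pow, one_pow]
      exact hk.le)
  have hshift : Measurable (fun x : E => δ + x) := by fun_prop
  let G : ProbabilityMeasure E := G₀.map hshift.aemeasurable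
  have hGdual (ℓ : StrongDual ℝ E) : charFunDual (G : Measure E) ℓ =
      Complex.exp (ℓ δ * Complex.I - covarianceBilinDual μ ℓ ℓ / 2) := by
    change charFunDual ((G₀ : Measure E).map (fun x => δ + x)) ℓ = _
    rw [charFunDual_map_const_add, hG₀L, hcov, ← Complex.exp_add]
    congr 1; ring
  have hGauss : IsGaussian (G : Measure E) := isGaussian_iff_gaussian_charFunDual.2
    ⟨δ, covarianceBilinDual μ, isPosSemidef_covarianceBilinDual, hGdual⟩
  obtain ⟨hmean, hcovG⟩ := gaussian_charFunDual_congr isPosSemidef_covarianceBilinDual hGdual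
  refine ⟨G, hGauss, hmean.symm, hcovG.symm, ?_⟩
  have hXm (j) (i) : AEMeasurable (X j i) (P j) := ((h j).law_X i).aemeasurable
  have hYm (j) (i) : AEMeasurable (Y j i) (P j) := ((h j).law_Y i).aemeasurable
  refine tendstoInDistribution_of_eventually_map_eq (fun j => ?_) aemeasurable_id
    (ProbabilityMeasure.tendsto_map_of_tendsto_of_continuous _ _ hG₀
      (f := fun x => δ + x) (by fun_prop)) (hpos.mono fun j hj => ?_) Measure.map_id
  · simp only [meanDiff, sampleMean]
    fun_prop
  · have hfun : (fun ω => meanDiff (fun i => X j i ω) (fun i => Y j i ω)) =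
        (fun x => δ + x) ∘ (fun x : Fin (m j) ⊕ Fin (n j) → E =>
          ∑ s, meanDiffWeight (m j) (n j) s • x s) ∘
        (fun ω s => centeredSample a (shrinkingShift δ (m j) (n j)) (X j) (Y j) s ω) := by
      ext ω
      exact meanDiff_eq_add_sum a δ hj.1 hj.2 _ _ ω
    have hcm : AEMeasurable
        (fun ω s => centeredSample a (shrinkingShift δ (m j) (n j)) (X j) (Y j) s ω) (P j) :=
      aemeasurable_pi_lambda _ fun s => ((h j).hasLaw_centeredSample a s).aemeasurable
    have hsm : Measurable (fun x : Fin (m j) ⊕ Fin (n j) → E =>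
        ∑ s, meanDiffWeight (m j) (n j) s • x s) := by fun_prop
    rw [hfun, ← AEMeasurable.map_map_of_aemeasurable hshift.aemeasurable
      (hsm.comp_aemeasurable hcm), ← AEMeasurable.map_map_of_aemeasurable hsm.aemeasurable hcm,
      (h j).map_centeredSample a]
    rfl

theorem exists_isGaussian_tendstoInDistribution_TCFF (hE : IsTypeTwo E)
    {m n : ℕ → ℕ} (hm : Tendsto m atTop atTop) (hn : Tendsto n atTop atTop)
    {Ω : ℕ → Type*} [∀ j, MeasurableSpace (Ω j)]
    {P : ∀ j, Measure (Ω j)} [∀ j, IsProbabilityMeasure (P j)]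
    {μ : Measure E} [IsProbabilityMeasure μ] {δ : E}
    {X : ∀ j, Fin (m j) → Ω j → E} {Y : ∀ j, Fin (n j) → Ω j → E}
    (h : ∀ j, IsShiftedTwoSample (P j) μ (shrinkingShift δ (m j) (n j)) (X j) (Y j))
    (hμ : MemLp id 2 μ) :
    ∃ (G : Measure E) (_ : IsGaussian G),
      ∫ x, x ∂G = δ ∧ covarianceBilinDual G = covarianceBilinDual μ ∧
      TendstoInDistribution (fun j ω => (n j : ℝ) / (m j + n j) *
          TCFF (fun i => X j i ω) (fun i => Y j i ω))
        atTop (fun x : E => ‖x‖ ^ 2) P G := by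
  obtain ⟨G, hG, hmean, hcov, hlim⟩ :=
    exists_isGaussian_tendstoInDistribution_meanDiff hE hm hn h hμ
  refine ⟨G, hG, hmean, hcov, ?_⟩
  have := hlim.continuous_comp (g := fun x : E => ‖x‖ ^ 2) (by fun_prop)
  refine this.congr (fun j => ae_of_all _ fun ω => ?_) (ae_of_all _ fun x => rfl)
  simp only [Function.comp_apply, meanDiff, TCFF]
  rw [norm_smul, mul_pow, Real.norm_eq_abs, sq_abs, Real.sq_sqrt (by positivity), norm_sub_rev]
  ring

end Weak

/-! ### Perturbation of leading eigenvalues and eigenvectors. -/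

section Spectral

variable {H : Type*} [NormedAddCommGroup H] [InnerProductSpace ℝ H]

/-- A compact symmetric operator is bounded above by any bound of its eigenvalues. -/
theorem inner_self_le_of_forall_eigenvalue_le [CompleteSpace H] {T : H →L[ℝ] H}
    (hT : IsCompactOperator T) (hs : T.IsSymmetric) {M : ℝ}
    (hM : ∀ (c : ℝ) (x : H), x ≠ 0 → T x = c • x → c ≤ M) (x : H) :
    ⟪T x, x⟫_ℝ ≤ M * ‖x‖ ^ 2 := by
  -- By the spectral theorem finite sums of eigenvectors are dense, and on them the quadratic form
  -- is diagonal; the bound is a closed condition.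
  have hdense : (⨆ c, Module.End.eigenspace (T : Module.End ℝ H) c).topologicalClosure = ⊤ :=
    (Submodule.topologicalClosure_eq_top_iff).2
      (ContinuousLinearMap.orthogonalComplement_iSup_eigenspaces_eq_bot hT hs)
  have hclosed : IsClosed {x : H | ⟪T x, x⟫_ℝ ≤ M * ‖x‖ ^ 2} :=
    isClosed_le (by fun_prop) (by fun_prop)
  have hsub : ((⨆ c, Module.End.eigenspace (T : Module.End ℝ H) c : Submodule ℝ H) : Set H) ⊆
      {x : H | ⟪T x, x⟫_ℝ ≤ M * ‖x‖ ^ 2} := by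
    intro y hy
    obtain ⟨f, hf, rfl⟩ := (Submodule.mem_iSup_iff_exists_finsupp _ _).1 hy
    have heig (c : ℝ) : T (f c) = c • f c := by
      simpa using Module.End.mem_eigenspace_iff.1 (hf c)
    have horth (c d : ℝ) (hcd : c ≠ d) : ⟪f c, f d⟫_ℝ = 0 := by
      have h1 : ⟪T (f c), f d⟫_ℝ = ⟪f c, T (f d)⟫_ℝ := hs _ _
      rw [heig, heig, inner_smul_left, inner_smul_right, conj_trivial, ← sub_eq_zero,
        ← sub_mul] at h1
      exact (mul_eq_zero.1 h1).resolve_left (sub_ne_zero.2 hcd)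
    have hinner (a : ℝ → ℝ) : ⟪∑ c ∈ f.support, a c • f c, ∑ c ∈ f.support, f c⟫_ℝ =
        ∑ c ∈ f.support, a c * ‖f c‖ ^ 2 := by
      rw [sum_inner]
      refine Finset.sum_congr rfl fun c hc => ?_
      rw [inner_sum, Finset.sum_eq_single c (fun d _ hd => by
        rw [inner_smul_left, horth c d hd.symm, mul_zero]) (fun h => absurd hc h),
        inner_smul_left, real_inner_self_eq_norm_sq, conj_trivial]
    simp only [Finsupp.sum, Set.mem_ofPred_eq, map_sum, heig]
    have h1 := hinner fun _ => 1
    simp only [one_smul, one_mul] at h1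
    rw [hinner (fun c => c), ← real_inner_self_eq_norm_sq, h1, Finset.mul_sum]
    refine Finset.sum_le_sum fun c hc => mul_le_mul_of_nonneg_right ?_ (by positivity)
    exact hM c (f c) (Finsupp.mem_support_iff.1 hc) (heig c)
  have hx : x ∈ (⨆ c, Module.End.eigenspace (T : Module.End ℝ H) c).topologicalClosure := by
    rw [hdense]; trivial
  exact (closure_minimal hsub hclosed) hx

variable {K : ℕ} {A : H →L[ℝ] H} {lam : Fin K → ℝ} {psi : Fin K → H}

namespace IsLeadingEigensystem

/-- The orthogonal complement of the `psi i` is invariant under `A`, and by `largest` every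
eigenvalue of the restriction is at most `lam k`. -/
theorem inner_self_le_of_orthogonal [CompleteSpace H] (h : IsLeadingEigensystem A lam psi)
    (hA : IsCompactOperator A) (hs : A.IsSymmetric) (k : Fin K) {x : H}
    (hx : ∀ i, ⟪psi i, x⟫_ℝ = 0) : ⟪A x, x⟫_ℝ ≤ lam k * ‖x‖ ^ 2 := by
  let V : Submodule ℝ H := (Submodule.span ℝ (Set.range psi))ᗮ
  have hmem {y : H} : y ∈ V ↔ ∀ i, ⟪psi i, y⟫_ℝ = 0 := by
    constructor
    · intro hy i
      exact (Submodule.mem_orthogonal _ _).1 hy _ (Submodule.subset_span ⟨i, rfl⟩)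
    · intro hy
      rw [Submodule.mem_orthogonal]
      intro u hu
      induction hu using Submodule.span_induction with
      | mem u hu => obtain ⟨i, rfl⟩ := hu; exact hy i
      | zero => exact inner_zero_left _
      | add u v _ _ hu hv => rw [inner_add_left, hu, hv, add_zero]
      | smul c u _ hu => rw [inner_smul_left, hu, mul_zero]
  have hinv : ∀ y ∈ V, A y ∈ V := by
    intro y hy
    refine hmem.2 fun i => ?_
    have h1 : ⟪A (psi i), y⟫_ℝ = ⟪psi i, A y⟫_ℝ := hs _ _
    rw [← h1, h.eigen, inner_smul_left, hmem.1 hy, mul_zero]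
  have hVc : CompleteSpace V := (Submodule.isClosed_orthogonal _).completeSpace_coe
  let T : V →L[ℝ] V := A.restrict hinv
  have hT : IsCompactOperator T := hA.restrict' hinv
  have hTs : T.IsSymmetric := hs.restrict_invariant hinv
  have := inner_self_le_of_forall_eigenvalue_le hT hTs (M := lam k) (fun c y hy hcy => by
    refine h.largest c y (by simpa using hy) ?_ (hmem.1 y.2) k
    exact congrArg Subtype.val hcy) ⟨x, hmem.2 hx⟩
  exact this

/-- The component of `x` orthogonal to the leading eigenvectors. -/
def residual (psi : Fin K → H) (x : H) : H := x - ∑ i, ⟪psi i, x⟫_ℝ • psi i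

theorem inner_residual (h : IsLeadingEigensystem A lam psi) (x : H) (i : Fin K) :
    ⟪psi i, residual psi x⟫_ℝ = 0 := by
  rw [residual, inner_sub_right, h.orthonormal.inner_right_fintype, sub_self]

theorem sum_add_residual (psi : Fin K → H) (x : H) :
    ∑ i, ⟪psi i, x⟫_ℝ • psi i + residual psi x = x := by
  simp [residual]

theorem norm_sq_eq (h : IsLeadingEigensystem A lam psi) (x : H) :
    ‖x‖ ^ 2 = ∑ i, ⟪psi i, x⟫_ℝ ^ 2 + ‖residual psi x‖ ^ 2 := by
  have h1 : ⟪x, x⟫_ℝ = ⟪∑ i, ⟪psi i, x⟫_ℝ • psi i + residual psi x, x⟫_ℝ := by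
    rw [sum_add_residual]
  have h2 : ⟪residual psi x, x⟫_ℝ = ‖residual psi x‖ ^ 2 := by
    conv_lhs => rw [← sum_add_residual psi x]
    rw [inner_add_right, inner_sum, Finset.sum_eq_zero, zero_add, sum_add_residual,
      real_inner_self_eq_norm_sq]
    intro i _
    rw [inner_smul_right, sum_add_residual, real_inner_comm (psi i) (residual psi x),
      h.inner_residual, mul_zero]
  rw [← real_inner_self_eq_norm_sq, h1, inner_add_left, h2, sum_inner]
  simp [inner_smul_left, pow_two]

theorem inner_residual_right (h : IsLeadingEigensystem A lam psi) (x : H) :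
    ⟪A x, residual psi x⟫_ℝ = ⟪A (residual psi x), residual psi x⟫_ℝ := by
  conv_lhs => rw [← sum_add_residual psi x]
  rw [map_add, inner_add_left, map_sum, sum_inner, Finset.sum_eq_zero, zero_add,
    sum_add_residual]
  intro i _
  rw [sum_add_residual, map_smul, h.eigen, inner_smul_left, inner_smul_left, h.inner_residual,
    mul_zero, mul_zero]

theorem inner_apply_self (h : IsLeadingEigensystem A lam psi) (hs : A.IsSymmetric) (x : H) :
    ⟪A x, x⟫_ℝ = ∑ i, lam i * ⟪psi i, x⟫_ℝ ^ 2 +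
      ⟪A (residual psi x), residual psi x⟫_ℝ := by
  have h1 : ⟪A x, x⟫_ℝ = ⟪A x, ∑ i, ⟪psi i, x⟫_ℝ • psi i + residual psi x⟫_ℝ := by
    rw [sum_add_residual]
  rw [h1, inner_add_right, h.inner_residual_right, inner_sum]
  congr 1
  refine Finset.sum_congr rfl fun i _ => ?_
  have h2 : ⟪A x, psi i⟫_ℝ = ⟪x, A (psi i)⟫_ℝ := hs _ _
  rw [inner_smul_right, h2, h.eigen, inner_smul_right, real_inner_comm x]
  ring

theorem inner_apply_self_le [CompleteSpace H] (h : IsLeadingEigensystem A lam psi)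
    (hA : IsCompactOperator A) (hs : A.IsSymmetric) (k : Fin K) {x : H}
    (hx : ∀ i < k, ⟪psi i, x⟫_ℝ = 0) : ⟪A x, x⟫_ℝ ≤ lam k * ‖x‖ ^ 2 := by
  rw [h.inner_apply_self hs, h.norm_sq_eq x, mul_add, Finset.mul_sum]
  refine add_le_add (Finset.sum_le_sum fun i _ => ?_)
    (h.inner_self_le_of_orthogonal hA hs k (h.inner_residual x))
  rcases lt_or_ge i k with hik | hik
  · simp [hx i hik]
  · exact mul_le_mul_of_nonneg_right (h.antitone hik) (sq_nonneg _)

/-- Weyl's inequality for the leading eigenvalues. -/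
theorem eigenvalue_le_add [CompleteSpace H] (h : IsLeadingEigensystem A lam psi)
    {K' : ℕ} {B : H →L[ℝ] H} {lam' : Fin K' → ℝ} {psi' : Fin K' → H}
    (h' : IsLeadingEigensystem B lam' psi') (hB : IsCompactOperator B) (hBs : B.IsSymmetric)
    {ε : ℝ} (hε : ‖A - B‖ ≤ ε) (k : Fin K) (k' : Fin K') (hk : (k : ℕ) = k') :
    lam k ≤ lam' k' + ε := by
  let ι : Fin ((k : ℕ) + 1) → Fin K := fun i => ⟨i, by omega⟩
  let ι' : Fin (k : ℕ) → Fin K' := fun i => ⟨i, by omega⟩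
  have hι : Function.Injective ι := fun i j hij => Fin.ext (by simpa [ι] using hij)
  have hort : Orthonormal ℝ (psi ∘ ι) := h.orthonormal.comp ι hι
  let F : (Fin ((k : ℕ) + 1) → ℝ) →ₗ[ℝ] H := Fintype.linearCombination ℝ (psi ∘ ι)
  let Φ : (Fin ((k : ℕ) + 1) → ℝ) →ₗ[ℝ] (Fin (k : ℕ) → ℝ) :=
    LinearMap.pi fun i => (innerSL ℝ (psi' (ι' i))).toLinearMap ∘ₗ F
  -- Courant–Fischer: k + 1 leading eigenvectors of `A` against k orthogonality conditions for `B`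
  -- leave a nonzero vector. The quadratic form of `A` there is at least `lam k`, that of `B` at
  -- most `lam' k'`, both relative to ‖x‖².
  have hker : LinearMap.ker Φ ≠ ⊥ := LinearMap.ker_ne_bot_of_finrank_lt (by simp)
  obtain ⟨t, ht, ht0⟩ := Submodule.exists_mem_ne_zero_of_ne_bot hker
  set x := F t with hx
  have hxsum : x = ∑ i, t i • psi (ι i) := by simp [hx, F, Fintype.linearCombination_apply]
  have hnorm : ‖x‖ ^ 2 = ∑ i, t i ^ 2 := by
    rw [← real_inner_self_eq_norm_sq, hxsum]
    have := hort.inner_sum t t Finset.univ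
    simpa [pow_two] using this
  have hAx : ⟪A x, x⟫_ℝ = ∑ i, lam (ι i) * t i ^ 2 := by
    rw [hxsum, map_sum]
    have := hort.inner_sum (fun i => t i * lam (ι i)) t Finset.univ
    simp only [Function.comp_apply, conj_trivial] at this
    simp only [map_smul, h.eigen, smul_smul]
    rw [this]
    exact Finset.sum_congr rfl fun i _ => by ring
  have hpos : 0 < ‖x‖ ^ 2 := by
    rw [hnorm]
    obtain ⟨i, hi⟩ := Function.ne_iff.1 ht0
    exact Finset.sum_pos' (fun i _ => sq_nonneg _) ⟨i, Finset.mem_univ _, by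
      have : t i ≠ 0 := hi
      positivity⟩
  have h1 : lam k * ‖x‖ ^ 2 ≤ ⟪A x, x⟫_ℝ := by
    rw [hAx, hnorm, Finset.mul_sum]
    refine Finset.sum_le_sum fun i _ => mul_le_mul_of_nonneg_right (h.antitone ?_) (sq_nonneg _)
    exact Fin.mk_le_of_le_val (by omega)
  have h2 : ⟪B x, x⟫_ℝ ≤ lam' k' * ‖x‖ ^ 2 := by
    refine h'.inner_apply_self_le hB hBs k' fun i hi => ?_
    have h3 := congrFun (LinearMap.mem_ker.1 ht) ⟨i, by rw [hk]; exact hi⟩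
    simpa [Φ, ι'] using h3
  have h3 : ⟪A x, x⟫_ℝ - ⟪B x, x⟫_ℝ ≤ ε * ‖x‖ ^ 2 := by
    rw [← inner_sub_left, ← sub_apply]
    calc ⟪(A - B) x, x⟫_ℝ ≤ ‖(A - B) x‖ * ‖x‖ := real_inner_le_norm _ _
      _ ≤ (‖A - B‖ * ‖x‖) * ‖x‖ := by gcongr; exact (A - B).le_opNorm x
      _ ≤ (ε * ‖x‖) * ‖x‖ := by gcongr
      _ = ε * ‖x‖ ^ 2 := by ring
  have h4 : lam k * ‖x‖ ^ 2 ≤ (lam' k' + ε) * ‖x‖ ^ 2 := by linarith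
  exact le_of_mul_le_mul_right h4 hpos

/-- An eigenvector of a small perturbation of `A` is close to the line spanned by the
corresponding eigenvector of `A`. -/
theorem one_sub_inner_sq_le [CompleteSpace H] (h : IsLeadingEigensystem A lam psi)
    (hA : IsCompactOperator A) (hs : A.IsSymmetric) {B : H →L[ℝ] H} {c : ℝ} {v : H}
    (hv : ‖v‖ = 1) (hBv : B v = c • v) {ε g : ℝ} (hε : ‖A - B‖ ≤ ε) (hg : 0 < g)
    (k l : Fin K) (hck : |c - lam k| ≤ g / 2) (hgap : ∀ i ≠ k, g ≤ |lam i - lam k|)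
    (hkl : k < l) :
    1 - ⟪psi k, v⟫_ℝ ^ 2 ≤ (K + 1) * (2 * ε / g) ^ 2 := by
  set e := (A - B) v with he
  have he_norm : ‖e‖ ≤ ε := by
    have := (A - B).le_opNorm v
    rw [hv, mul_one] at this
    exact this.trans hε
  have hε0 : 0 ≤ ε := (norm_nonneg _).trans he_norm
  have heA : e = A v - c • v := by rw [he, sub_apply, hBv]
  -- Pairing e = A v − c v with ψᵢ gives (λᵢ − c)⟨ψᵢ, v⟩, and c stays at distance at least g/2 from
  -- λᵢ.
  have hcoef (i : Fin K) (hi : i ≠ k) : ⟪psi i, v⟫_ℝ ^ 2 ≤ (2 * ε / g) ^ 2 := by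
    have h1 : ⟪psi i, e⟫_ℝ = (lam i - c) * ⟪psi i, v⟫_ℝ := by
      have h2 : ⟪A (psi i), v⟫_ℝ = ⟪psi i, A v⟫_ℝ := hs _ _
      rw [heA, inner_sub_right, ← h2, h.eigen, inner_smul_left, inner_smul_right, conj_trivial]
      ring
    have h3 : |⟪psi i, e⟫_ℝ| ≤ ε := by
      refine (abs_real_inner_le_norm _ _).trans ?_
      rwa [h.orthonormal.1 i, one_mul]
    have h4 : g / 2 ≤ |lam i - c| := by
      have h5 := hgap i hi
      have h6 : |lam i - lam k| ≤ |lam i - c| + |c - lam k| := abs_sub_le _ _ _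
      linarith
    rw [h1, abs_mul] at h3
    have h5 : g / 2 * |⟪psi i, v⟫_ℝ| ≤ ε :=
      (mul_le_mul_of_nonneg_right h4 (abs_nonneg _)).trans h3
    rw [← sq_abs]
    refine pow_le_pow_left₀ (abs_nonneg _) ?_ 2
    rw [le_div_iff₀ hg]; linarith
  -- On the residual the form of `A` is at most λₗ, and l > k makes c − λₗ at least g/2. This is why
  -- one more eigenvalue than the number of estimated directions is needed.
  have hres : ‖residual psi v‖ ^ 2 ≤ (2 * ε / g) ^ 2 := by
    set r := residual psi v with hr
    have h1 : ⟪e, r⟫_ℝ = ⟪A r, r⟫_ℝ - c * ‖r‖ ^ 2 := by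
      have h2 : ⟪v, r⟫_ℝ = ‖r‖ ^ 2 := by
        conv_lhs => rw [← sum_add_residual psi v]
        rw [inner_add_left, sum_inner, Finset.sum_eq_zero, zero_add, real_inner_self_eq_norm_sq]
        intro i _
        rw [inner_smul_left, h.inner_residual, mul_zero]
      rw [heA, inner_sub_left, h.inner_residual_right, inner_smul_left, h2, conj_trivial]
    have h2 := h.inner_self_le_of_orthogonal hA hs l (h.inner_residual v)
    have h3 : -⟪e, r⟫_ℝ ≤ ε * ‖r‖ := by
      have := abs_real_inner_le_norm e r
      have h4 : ‖e‖ * ‖r‖ ≤ ε * ‖r‖ := by gcongr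
      linarith [neg_abs_le ⟪e, r⟫_ℝ]
    have h4 : g ≤ lam k - lam l := by
      have := hgap l hkl.ne'
      rwa [abs_sub_comm, abs_of_nonneg (sub_nonneg.2 (h.antitone hkl.le))] at this
    have h5 : g / 2 ≤ c - lam l := by linarith [(abs_le.1 hck).1]
    have h6 : g / 2 * ‖r‖ ^ 2 ≤ ε * ‖r‖ := by
      have := mul_le_mul_of_nonneg_right h5 (sq_nonneg ‖r‖)
      linarith
    refine pow_le_pow_left₀ (norm_nonneg _) ?_ 2
    rcases (norm_nonneg r).eq_or_lt with h0 | h0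
    · rw [← h0]; positivity
    · rw [le_div_iff₀ hg]
      have : g / 2 * ‖r‖ ≤ ε := by
        refine le_of_mul_le_mul_right ?_ h0
        linarith [h6]
      linarith
  have hn := h.norm_sq_eq v
  rw [hv, one_pow, ← Finset.add_sum_erase _ _ (Finset.mem_univ k)] at hn
  have hsum : ∑ i ∈ Finset.univ.erase k, ⟪psi i, v⟫_ℝ ^ 2 ≤ K * (2 * ε / g) ^ 2 := by
    refine (Finset.sum_le_card_nsmul _ _ ((2 * ε / g) ^ 2)
      fun i hi => hcoef i (Finset.ne_of_mem_erase hi)).trans ?_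
    rw [nsmul_eq_mul]
    gcongr
    exact (Finset.card_le_univ _).trans (by simp)
  linarith

end IsLeadingEigensystem

/-- Factor the difference of squares: ‖v − u‖ ‖v + u‖ = 2 √(1 − ⟨u, v⟩²), which is unchanged when v
is replaced by −v, so no choice of sign is needed. -/
theorem abs_inner_sq_sub_inner_sq_le {u v : H} (hu : ‖u‖ = 1) (hv : ‖v‖ = 1) {η : ℝ} (hη : 0 ≤ η)
    (huv : 1 - ⟪u, v⟫_ℝ ^ 2 ≤ η ^ 2) (z : H) :
    |⟪z, v⟫_ℝ ^ 2 - ⟪z, u⟫_ℝ ^ 2| ≤ 2 * η * ‖z‖ ^ 2 := by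
  have h1 : ⟪z, v⟫_ℝ ^ 2 - ⟪z, u⟫_ℝ ^ 2 = ⟪z, v - u⟫_ℝ * ⟪z, v + u⟫_ℝ := by
    rw [inner_sub_right, inner_add_right]; ring
  have h2 : ‖v - u‖ ^ 2 * ‖v + u‖ ^ 2 = 4 * (1 - ⟪u, v⟫_ℝ ^ 2) := by
    rw [norm_sub_sq_real, norm_add_sq_real, hu, hv, real_inner_comm]; ring
  have h3 : ‖v - u‖ * ‖v + u‖ ≤ 2 * η := by
    refine le_of_sq_le_sq ?_ (by positivity)
    rw [mul_pow, h2]; linarith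
  rw [h1, abs_mul]
  calc |⟪z, v - u⟫_ℝ| * |⟪z, v + u⟫_ℝ| ≤ (‖z‖ * ‖v - u‖) * (‖z‖ * ‖v + u‖) :=
        mul_le_mul (abs_real_inner_le_norm _ _) (abs_real_inner_le_norm _ _) (abs_nonneg _)
          (by positivity)
    _ = (‖v - u‖ * ‖v + u‖) * ‖z‖ ^ 2 := by ring
    _ ≤ _ := by gcongr

theorem exists_forall_ne_le_abs_sub {K : ℕ} {lam : Fin K → ℝ} (h : Function.Injective lam) :
    ∃ g : ℝ, 0 < g ∧ ∀ i k, i ≠ k → g ≤ |lam i - lam k| := by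
  let S : Finset (Fin K × Fin K) := Finset.univ.filter fun p => p.1 ≠ p.2
  have hS : ∃ g : ℝ, 0 < g ∧ ∀ p ∈ S, g ≤ |lam p.1 - lam p.2| := by
    rcases S.eq_empty_or_nonempty with h0 | h0
    · exact ⟨1, one_pos, fun p hp => by simp [h0] at hp⟩
    · obtain ⟨p, hp, hmin⟩ := S.exists_min_image (fun p => |lam p.1 - lam p.2|) h0
      refine ⟨_, abs_pos.2 (sub_ne_zero.2 fun h2 => ?_), hmin⟩
      exact (Finset.mem_filter.1 hp).2 (h h2)
  obtain ⟨g, hg, hgs⟩ := hS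
  exact ⟨g, hg, fun i k hik => hgs (i, k) (Finset.mem_filter.2 ⟨Finset.mem_univ _, hik⟩)⟩

/-- Continuity of the leading eigenvalues and eigenvectors, up to sign, of a compact symmetric
operator with simple leading eigenvalues. -/
theorem IsLeadingEigensystem.exists_perturbation_bound [CompleteSpace H] {L : ℕ}
    {lam : Fin (L + 1) → ℝ} {psi : Fin (L + 1) → H} (h : IsLeadingEigensystem A lam psi)
    (hA : IsCompactOperator A) (hs : A.IsSymmetric) (hlam : StrictAnti lam) {η : ℝ} (hη : 0 < η) :
    ∃ ε : ℝ, 0 < ε ∧ ∀ (B : H →L[ℝ] H) (lam' : Fin L → ℝ) (psi' : Fin L → H),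
      IsCompactOperator B → B.IsSymmetric → IsLeadingEigensystem B lam' psi' → ‖A - B‖ ≤ ε →
      ∀ k : Fin L, |lam' k - lam k.castSucc| ≤ η ∧
        ∀ z, |⟪z, psi' k⟫_ℝ ^ 2 - ⟪z, psi k.castSucc⟫_ℝ ^ 2| ≤ 2 * η * ‖z‖ ^ 2 := by
  obtain ⟨g, hg, hgap⟩ := exists_forall_ne_le_abs_sub hlam.injective
  -- The first two bounds serve the eigenvalues, through Weyl's inequality. The third gives 2ε/g ≤
  -- η/(L + 2), so the eigenvector error (L + 2)(2ε/g)² is at most η².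
  refine ⟨min (min η (g / 2)) (η * g / (2 * (L + 2))), by positivity, ?_⟩
  intro B lam' psi' hB hBs h' hAB k
  have h1 := h.eigenvalue_le_add h' hB hBs hAB k.castSucc k rfl
  have h2 := h'.eigenvalue_le_add h hA hs ((norm_sub_rev B A).trans_le hAB) k k.castSucc rfl
  set ε := min (min η (g / 2)) (η * g / (2 * (L + 2))) with hε
  have hεη : ε ≤ η := (min_le_left _ _).trans (min_le_left _ _)
  have hεg : ε ≤ g / 2 := (min_le_left _ _).trans (min_le_right _ _)
  have hε3 : ε ≤ η * g / (2 * (L + 2)) := min_le_right _ _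
  have hε0 : 0 ≤ ε := (norm_nonneg _).trans hAB
  have hab : |lam' k - lam k.castSucc| ≤ ε := abs_le.2 ⟨by linarith, by linarith⟩
  refine ⟨hab.trans hεη, abs_inner_sq_sub_inner_sq_le (h.orthonormal.1 _) (h'.orthonormal.1 _)
    hη.le ?_⟩
  refine (h.one_sub_inner_sq_le hA hs (h'.orthonormal.1 k) (h'.eigen k) hAB hg k.castSucc
    (Fin.last L) (hab.trans hεg) (fun i hi => hgap i _ hi) (Fin.castSucc_lt_last k)).trans ?_
  have h3 : 2 * ε / g ≤ η / (L + 2) := by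
    rw [div_le_div_iff₀ hg (by positivity)]
    rw [le_div_iff₀ (by positivity)] at hε3
    linarith
  have h4 : (2 * ε / g) ^ 2 ≤ (η / (L + 2)) ^ 2 := pow_le_pow_left₀ (by positivity) h3 2
  calc (((L + 1 : ℕ) : ℝ) + 1) * (2 * ε / g) ^ 2 ≤ (L + 2) ^ 2 * (η / (L + 2)) ^ 2 := by
        refine mul_le_mul ?_ h4 (sq_nonneg _) (sq_nonneg _)
        push_cast
        have : (0 : ℝ) ≤ L := by positivity
        nlinarith
    _ = η ^ 2 := by field_simp

end Spectral

/-! ### Hilbert spaces are of type 2. -/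

section TypeTwoHilbert

variable {H : Type*} [NormedAddCommGroup H] [InnerProductSpace ℝ H] [CompleteSpace H]
  [SecondCountableTopology H] [MeasurableSpace H] [BorelSpace H]

omit [CompleteSpace H] [SecondCountableTopology H] [MeasurableSpace H] [BorelSpace H] in
theorem integrable_inner_of_memLp_two {Ω : Type*} [MeasurableSpace Ω] {P : Measure Ω}
    {U V : Ω → H} (hU : MemLp U 2 P) (hV : MemLp V 2 P) :
    Integrable (fun ω => ⟪U ω, V ω⟫_ℝ) P :=
  (MemLp.integrable_mul hU.norm hV.norm).mono'
    (hU.aestronglyMeasurable.inner hV.aestronglyMeasurable)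
    (ae_of_all _ fun _ => abs_real_inner_le_norm _ _)

theorem integral_inner_eq_zero_of_indepFun {Ω : Type*} [MeasurableSpace Ω] {P : Measure Ω}
    [IsProbabilityMeasure P] {U V : Ω → H} (h : IndepFun U V P) (hU : MemLp U 2 P)
    (hV : MemLp V 2 P) (hV0 : ∫ ω, V ω ∂P = 0) : ∫ ω, ⟪U ω, V ω⟫_ℝ ∂P = 0 := by
  have hUm := hU.aestronglyMeasurable.aemeasurable
  have hVm := hV.aestronglyMeasurable.aemeasurable
  have hprod := (indepFun_iff_map_prod_eq_prod_map_map hUm hVm).1 h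
  have : IsProbabilityMeasure (P.map U) := Measure.isProbabilityMeasure_map hUm
  have : IsProbabilityMeasure (P.map V) := Measure.isProbabilityMeasure_map hVm
  have hint : Integrable (fun ω => ⟪U ω, V ω⟫_ℝ) P := integrable_inner_of_memLp_two hU hV
  have hc : Continuous fun p : H × H => ⟪p.1, p.2⟫_ℝ := by fun_prop
  have hVid : Integrable (fun x : H => x) (P.map V) :=
    (integrable_map_measure (by fun_prop) hVm).2 (hV.integrable (by simp))
  have h0 : ∫ x, x ∂(P.map V) = 0 := by rw [integral_map hVm (by fun_prop)]; exact hV0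
  have h1 : ∫ ω, ⟪U ω, V ω⟫_ℝ ∂P = ∫ p, ⟪p.1, p.2⟫_ℝ ∂((P.map U).prod (P.map V)) := by
    rw [← hprod, integral_map (hUm.prodMk hVm) hc.aestronglyMeasurable]
  rw [h1, integral_prod _ (by
    rw [← hprod, integrable_map_measure hc.aestronglyMeasurable (hUm.prodMk hVm)]
    exact hint)]
  simp [integral_inner hVid, h0]

/-- A Hilbert space is of type 2. -/
theorem isTypeTwo_of_innerProductSpace : IsTypeTwo H := by
  -- Equality holds with b = 1: the cross terms vanish by independence and centring.
  refine ⟨1, one_pos, fun Ω _ P _ n U _ hind h2 h0 => le_of_eq ?_⟩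
  have hint (i j : Fin n) : Integrable (fun ω => ⟪U i ω, U j ω⟫_ℝ) P :=
    integrable_inner_of_memLp_two (h2 i) (h2 j)
  simp only [← real_inner_self_eq_norm_sq, sum_inner, inner_sum]
  rw [one_mul, integral_finsetSum _ fun i _ => integrable_finsetSum _ fun j _ => hint _ _]
  refine Finset.sum_congr rfl fun i _ => ?_
  rw [integral_finsetSum _ fun j _ => hint _ _, Finset.sum_eq_single i]
  · intro j _ hji
    exact integral_inner_eq_zero_of_indepFun (hind.indepFun hji) (h2 j) (h2 i) (h0 i)
  · simp

end TypeTwoHilbert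

/-! ### The weak law of large numbers. -/

section WeakLaw

/-- The weak law of large numbers for triangular arrays with i.i.d. rows. -/
theorem tendsto_measure_norm_average_sub_ge {E B : Type*} [NormedAddCommGroup E]
    [SecondCountableTopology E] [MeasurableSpace E] [BorelSpace E]
    [NormedAddCommGroup B] [NormedSpace ℝ B] [CompleteSpace B]
    {μ : Measure E} [IsProbabilityMeasure μ] {V : E → B} (hV : Continuous V)
    (hVint : Integrable V μ) {k : ℕ → ℕ} (hk : Tendsto k atTop atTop)
    {Ω : ℕ → Type*} [∀ j, MeasurableSpace (Ω j)] {P : ∀ j, Measure (Ω j)}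
    [∀ j, IsProbabilityMeasure (P j)] {U : ∀ j, Fin (k j) → Ω j → E}
    (hU : ∀ j i, AEMeasurable (U j i) (P j))
    (hlaw : ∀ j, (P j).map (fun ω i => U j i ω) = Measure.pi fun _ => μ) {ε : ℝ} (hε : 0 < ε) :
    Tendsto (fun j => P j {ω | ε ≤ ‖(k j : ℝ)⁻¹ • ∑ i, V (U j i ω) - ∫ x, V x ∂μ‖}) atTop
      (𝓝 0) := by
  borelize B
  -- The probability in question depends only on the law of the row, so each row may be replaced by
  -- the first `k j` terms of one i.i.d. sequence, to which the strong law applies.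
  let Q : Measure (ℕ → E) := Measure.infinitePi fun _ => μ
  have hev (i : ℕ) : MeasurePreserving (fun x : ℕ → E => x i) Q μ :=
    measurePreserving_eval_infinitePi (fun _ : ℕ => μ) i
  have hind : iIndepFun (fun (i : ℕ) (x : ℕ → E) => V (x i)) Q :=
    iIndepFun_infinitePi (X := fun _ => V) fun _ => hV.measurable
  have hslln := strong_law_ae (μ := Q) (fun i x => V (x i))
    ((hev 0).integrable_comp_of_integrable hVint)
    (fun i j hij => hind.indepFun hij)
    (fun i => ⟨(hV.measurable.comp (measurable_pi_apply i)).aemeasurable,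
      (hV.measurable.comp (measurable_pi_apply 0)).aemeasurable, by
        have (i : ℕ) : Q.map (fun x => V (x i)) = μ.map V := by
          rw [← (hev i).map_eq, Measure.map_map hV.measurable (measurable_pi_apply i)]
          rfl
        rw [this, this]⟩)
  have hmean : ∫ x, V (x 0) ∂Q = ∫ x, V x ∂μ := by
    have h1 := integral_map (μ := Q) (φ := fun x : ℕ → E => x 0) (f := V)
      (measurable_pi_apply _).aemeasurable hV.aestronglyMeasurable
    rw [← h1, (hev 0).map_eq]
  rw [hmean] at hslln
  have hmeas := tendstoInMeasure_of_tendsto_ae (μ := Q) (fun j => by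
    have hVs := hV.stronglyMeasurable
    have : StronglyMeasurable fun ω : ℕ → E => ∑ i ∈ Finset.range j, V (ω i) := by
      refine Finset.stronglyMeasurable_fun_sum _ fun i _ => ?_
      exact hVs.comp_measurable (measurable_pi_apply i)
    exact (this.const_smul ((j : ℝ)⁻¹)).aestronglyMeasurable) hslln
  have hlim := ((tendstoInMeasure_iff_norm.1 hmeas) ε hε).comp hk
  refine hlim.congr fun j => ?_
  have hcont : Continuous fun y : Fin (k j) → E =>
      ‖(k j : ℝ)⁻¹ • ∑ i, V (y i) - ∫ x, V x ∂μ‖ := by fun_prop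
  have hset : MeasurableSet {y : Fin (k j) → E |
      ε ≤ ‖(k j : ℝ)⁻¹ • ∑ i, V (y i) - ∫ x, V x ∂μ‖} :=
    measurableSet_le measurable_const hcont.measurable
  have hQ : Q.map (fun (x : ℕ → E) (i : Fin (k j)) => x i) = Measure.pi fun _ => μ := by
    rw [Measure.map_infinitePi_infinitePi_of_inj (P := fun _ : ℕ => μ)
      (f := fun i : Fin (k j) => (i : ℕ)) Fin.val_injective, Measure.infinitePi_eq_pi]
  have hE1 : Q {x | ε ≤ ‖(k j : ℝ)⁻¹ • ∑ i : Fin (k j), V (x i) - ∫ x, V x ∂μ‖} =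
      (Measure.pi fun _ : Fin (k j) => μ) {y |
        ε ≤ ‖(k j : ℝ)⁻¹ • ∑ i, V (y i) - ∫ x, V x ∂μ‖} := by
    rw [← hQ, Measure.map_apply (measurable_pi_lambda _ fun i => measurable_pi_apply _) hset]
    rfl
  have hE2 : P j {ω | ε ≤ ‖(k j : ℝ)⁻¹ • ∑ i, V (U j i ω) - ∫ x, V x ∂μ‖} =
      (Measure.pi fun _ : Fin (k j) => μ) {y |
        ε ≤ ‖(k j : ℝ)⁻¹ • ∑ i, V (y i) - ∫ x, V x ∂μ‖} := by
    rw [← hlaw, Measure.map_apply_of_aemeasurable (aemeasurable_pi_lambda _ (hU j)) hset]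
    rfl
  rw [hE2, ← hE1]
  simp only [Function.comp_apply, Finset.sum_range]

end WeakLaw

/-! ### Compactness, symmetry and integral form of the covariance operators. -/

section Covariance

variable {H : Type*} [NormedAddCommGroup H] [InnerProductSpace ℝ H]

theorem isCompactOperator_rankOne (x y : H) :
    IsCompactOperator (InnerProductSpace.rankOne ℝ x y) := by
  have h := (isCompactOperator_of_locallyCompactSpace_dom
    (innerSL ℝ y)).clm_comp (ContinuousLinearMap.toSpanSingleton ℝ x)
  rw [InnerProductSpace.rankOne_def']
  exact h

theorem isCompactOperator_scatterOperator {n : ℕ} (x : Fin n → H) :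
    IsCompactOperator (scatterOperator x) := by
  have : scatterOperator x ∈ compactOperator (RingHom.id ℝ) H H :=
    Submodule.sum_mem _ fun i _ => isCompactOperator_rankOne _ _
  exact this

theorem isCompactOperator_pooledCov {m n : ℕ} (x : Fin m → H) (y : Fin n → H) :
    IsCompactOperator (pooledCov x y) :=
  ((isCompactOperator_scatterOperator x).add (isCompactOperator_scatterOperator y)).smul _

theorem isSymmetric_scatterOperator {n : ℕ} (x : Fin n → H) :
    (scatterOperator x).IsSymmetric := by
  intro u v
  simp only [scatterOperator, ContinuousLinearMap.coe_coe, sum_apply,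
    InnerProductSpace.rankOne_apply, sum_inner, inner_sum, inner_smul_left, inner_smul_right,
    conj_trivial]
  refine Finset.sum_congr rfl fun i _ => ?_
  rw [real_inner_comm u, mul_comm]

theorem isSymmetric_pooledCov {m n : ℕ} (x : Fin m → H) (y : Fin n → H) :
    (pooledCov x y).IsSymmetric := by
  intro u v
  have h1 := isSymmetric_scatterOperator x u v
  have h2 := isSymmetric_scatterOperator y u v
  simp only [ContinuousLinearMap.coe_coe] at h1 h2
  simp only [pooledCov, ContinuousLinearMap.coe_coe, smul_apply, add_apply, inner_smul_left,
    inner_smul_right, inner_add_left, inner_add_right, conj_trivial, h1, h2]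

theorem continuous_rankOne_self : Continuous fun z : H => InnerProductSpace.rankOne ℝ z z :=
  (InnerProductSpace.rankOne ℝ).continuous.clm_apply continuous_id

/-- Steiner's identity. Centring at the true mean in place of the sample mean leaves a sum of i.i.d.
terms and a correction governed by the averaged deviation. -/
theorem scatterOperator_eq {n : ℕ} (x : Fin n → H) (a : H) :
    scatterOperator x = ∑ i, InnerProductSpace.rankOne ℝ (x i - a) (x i - a) -
      (n : ℝ) • InnerProductSpace.rankOne ℝ ((n : ℝ)⁻¹ • ∑ i, (x i - a))
        ((n : ℝ)⁻¹ • ∑ i, (x i - a)) := by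
  rcases Nat.eq_zero_or_pos n with rfl | hn
  · simp [scatterOperator]
  have hn' : (n : ℝ) ≠ 0 := by positivity
  set w : H := (n : ℝ)⁻¹ • ∑ i, (x i - a) with hw
  have hsum : ∑ i, (x i - a) = (n : ℝ) • w := by rw [hw, smul_smul, mul_inv_cancel₀ hn', one_smul]
  have hmean (i : Fin n) : x i - sampleMean x = (x i - a) - w := by
    rw [hw, sampleMean, Finset.sum_sub_distrib, smul_sub, Finset.sum_const, Finset.card_univ,
      Fintype.card_fin, ← Nat.cast_smul_eq_nsmul ℝ, smul_smul, inv_mul_cancel₀ hn', one_smul]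
    abel
  simp only [scatterOperator, hmean]
  clear_value w
  generalize hu : (fun i => x i - a) = u at hsum
  have hu' (i : Fin n) : x i - a = u i := congrFun hu i
  simp only [hu'] at hsum ⊢
  have hs1 : ∑ i, InnerProductSpace.rankOne ℝ (u i) w =
      (n : ℝ) • InnerProductSpace.rankOne ℝ w w := by
    rw [← sum_apply, ← map_sum, hsum, map_smul, smul_apply]
  have hs2 : ∑ i, InnerProductSpace.rankOne ℝ w (u i) =
      (n : ℝ) • InnerProductSpace.rankOne ℝ w w := by
    rw [← map_sum, hsum]; simp
  simp only [map_sub, sub_apply, Finset.sum_sub_distrib]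
  rw [hs1, hs2]
  simp [← Nat.cast_smul_eq_nsmul ℝ]

variable [CompleteSpace H] [SecondCountableTopology H] [MeasurableSpace H] [BorelSpace H]

omit [CompleteSpace H] in
theorem integrable_rankOne_self {μ : Measure H} (hμ : MemLp id 2 μ) :
    Integrable (fun z => InnerProductSpace.rankOne ℝ z z) μ := by
  have h1 : Integrable (fun z : H => ‖z‖ ^ 2) μ := hμ.integrable_norm_pow (by simp)
  have : SecondCountableTopologyEither H (H →L[ℝ] H) := secondCountableTopologyEither_of_left ..
  refine h1.mono continuous_rankOne_self.stronglyMeasurable.aestronglyMeasurable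
    (ae_of_all _ fun z => ?_)
  rw [InnerProductSpace.norm_rankOne, Real.norm_of_nonneg (by positivity), pow_two]

/-- As a Bochner integral in operator norm, the covariance is the limit in the law of large numbers,
and it inherits compactness from the rank one operators. -/
theorem covOperator_eq_integral {μ : Measure H} [IsProbabilityMeasure μ] (hμ : MemLp id 2 μ) :
    covOperator μ = ∫ z, InnerProductSpace.rankOne ℝ z z ∂(μ.map fun x => x - ∫ y, y ∂μ) := by
  have hμ₀ : MemLp id 2 (μ.map fun x => x - ∫ y, y ∂μ) :=
    (memLp_map_measure_iff (by fun_prop) (by fun_prop)).2 (hμ.sub (memLp_const _))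
  have hint := integrable_rankOne_self hμ₀
  refine ContinuousLinearMap.ext fun x => ext_inner_right ℝ fun y => ?_
  rw [covOperator, InnerProductSpace.continuousLinearMapOfBilin_apply, covarianceBilin_apply hμ,
    ContinuousLinearMap.integral_apply hint,
    ← real_inner_comm, ← integral_inner (hint.apply_continuousLinearMap x)]
  rw [integral_map (by fun_prop)
    (Continuous.aestronglyMeasurable (by
      simp only [InnerProductSpace.rankOne_apply]; fun_prop))]
  simp only [InnerProductSpace.rankOne_apply, inner_smul_right, id]
  refine integral_congr_ae (ae_of_all _ fun z => ?_)
  simp only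
  rw [real_inner_comm x]

theorem isCompactOperator_covOperator {μ : Measure H} [IsProbabilityMeasure μ]
    (hμ : MemLp id 2 μ) : IsCompactOperator (covOperator μ) := by
  have hμ₀ : MemLp id 2 (μ.map fun x => x - ∫ y, y ∂μ) :=
    (memLp_map_measure_iff (by fun_prop) (by fun_prop)).2 (hμ.sub (memLp_const _))
  have : IsProbabilityMeasure (μ.map fun x => x - ∫ y, y ∂μ) :=
    Measure.isProbabilityMeasure_map (by fun_prop)
  rw [covOperator_eq_integral hμ]
  have hconv : Convex ℝ ((compactOperator (RingHom.id ℝ) H H : Submodule ℝ (H →L[ℝ] H)) :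
      Set (H →L[ℝ] H)) := Submodule.convex _
  exact hconv.integral_mem isClosed_setOfPred_isCompactOperator
    (ae_of_all _ fun z => isCompactOperator_rankOne z z) (integrable_rankOne_self hμ₀)

omit [SecondCountableTopology H] in
theorem isSymmetric_covOperator (μ : Measure H) : (covOperator μ).IsSymmetric := by
  intro x y
  simp only [ContinuousLinearMap.coe_coe, covOperator]
  rw [InnerProductSpace.continuousLinearMapOfBilin_apply, real_inner_comm,
    InnerProductSpace.continuousLinearMapOfBilin_apply, covarianceBilin_comm]

end Covariance

/-! ### Consistency of the pooled covariance. -/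

section Consistency

variable {H : Type*} [NormedAddCommGroup H] [InnerProductSpace ℝ H] [CompleteSpace H]
  [SecondCountableTopology H] [MeasurableSpace H] [BorelSpace H]

omit [CompleteSpace H] [SecondCountableTopology H] [MeasurableSpace H] [BorelSpace H] in
theorem norm_inv_smul_scatterOperator_sub_le {n : ℕ} (hn : 0 < n) (x : Fin n → H) (a : H)
    (S : H →L[ℝ] H) :
    ‖scatterOperator x - (n : ℝ) • S‖ ≤ n *
      (‖(n : ℝ)⁻¹ • ∑ i, InnerProductSpace.rankOne ℝ (x i - a) (x i - a) - S‖ +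
        ‖(n : ℝ)⁻¹ • ∑ i, (x i - a)‖ ^ 2) := by
  have hn' : (n : ℝ) ≠ 0 := by positivity
  set w : H := (n : ℝ)⁻¹ • ∑ i, (x i - a) with hw
  have h1 : scatterOperator x - (n : ℝ) • S = (n : ℝ) •
      (((n : ℝ)⁻¹ • ∑ i, InnerProductSpace.rankOne ℝ (x i - a) (x i - a) - S) -
        InnerProductSpace.rankOne ℝ w w) := by
    rw [scatterOperator_eq x a, smul_sub, smul_sub, smul_smul, mul_inv_cancel₀ hn', one_smul]
    abel
  rw [h1, norm_smul, Real.norm_of_nonneg (by positivity)]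
  gcongr
  refine (norm_sub_le _ _).trans ?_
  rw [InnerProductSpace.norm_rankOne, pow_two]

/-- The pooled covariance is consistent, in operator norm. -/
theorem tendsto_measure_norm_covOperator_sub_pooledCov_ge
    {m n : ℕ → ℕ} (hm : Tendsto m atTop atTop) (hn : Tendsto n atTop atTop)
    {Ω : ℕ → Type*} [∀ j, MeasurableSpace (Ω j)]
    {P : ∀ j, Measure (Ω j)} [∀ j, IsProbabilityMeasure (P j)]
    {μ : Measure H} [IsProbabilityMeasure μ] {Δ : ℕ → H}
    {X : ∀ j, Fin (m j) → Ω j → H} {Y : ∀ j, Fin (n j) → Ω j → H}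
    (h : ∀ j, IsShiftedTwoSample (P j) μ (Δ j) (X j) (Y j))
    (hμ : MemLp id 2 μ) {ε : ℝ} (hε : 0 < ε) :
    Tendsto (fun j => P j {ω | ε ≤
      ‖covOperator μ - pooledCov (fun i => X j i ω) (fun i => Y j i ω)‖}) atTop (𝓝 0) := by
  set a : H := ∫ x, x ∂μ with ha
  set μ₀ := μ.map (fun x => x - a) with hμ₀
  have : IsProbabilityMeasure μ₀ := Measure.isProbabilityMeasure_map (by fun_prop)
  have hμ₀2 : MemLp id 2 μ₀ :=
    (memLp_map_measure_iff (by fun_prop) (by fun_prop)).2 (hμ.sub (memLp_const a))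
  have hμ₀0 : ∫ x, x ∂μ₀ = 0 := integral_map_sub_integral hμ
  have hμ₀S : ∫ z, InnerProductSpace.rankOne ℝ z z ∂μ₀ = covOperator μ :=
    (covOperator_eq_integral hμ).symm
  set S := covOperator μ
  have hid : Integrable (fun x : H => x) μ₀ := hμ₀2.integrable (by simp)
  have hXlaw (j : ℕ) : (P j).map (fun ω i => X j i ω - a) = Measure.pi fun _ => μ₀ := by
    have hI := ((h j).iIndepFun_centeredSample a).precomp
      (g := (Sum.inl : Fin (m j) → Fin (m j) ⊕ Fin (n j))) Sum.inl_injective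
    have hl (i) := (h j).hasLaw_centeredSample a (Sum.inl i)
    have := (iIndepFun_iff_map_fun_eq_pi_map fun i => (hl i).aemeasurable).1 hI
    simp only [(hl _).map_eq] at this
    exact this
  have hYlaw (j : ℕ) : (P j).map (fun ω i => Y j i ω - Δ j - a) = Measure.pi fun _ => μ₀ := by
    have hI := ((h j).iIndepFun_centeredSample a).precomp
      (g := (Sum.inr : Fin (n j) → Fin (m j) ⊕ Fin (n j))) Sum.inr_injective
    have hl (i) := (h j).hasLaw_centeredSample a (Sum.inr i)
    have := (iIndepFun_iff_map_fun_eq_pi_map fun i => (hl i).aemeasurable).1 hI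
    simp only [(hl _).map_eq] at this
    exact this
  have hXm (j) (i) : AEMeasurable (fun ω => X j i ω - a) (P j) :=
    ((h j).law_X i).aemeasurable.sub_const a
  have hYm (j) (i) : AEMeasurable (fun ω => Y j i ω - Δ j - a) (P j) :=
    (((h j).law_Y i).aemeasurable.sub_const _).sub_const a
  -- Each sample contributes at most 2ε/10 times its size, and the normalization N − 2 a further m
  -- ε/10. The total (3m + 2n) ε/10 is below (m + n − 2) ε as soon as m, n ≥ 2.
  have hη : 0 < ε / 10 := by positivity
  have h1 := tendsto_measure_norm_average_sub_ge continuous_rankOne_self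
    (integrable_rankOne_self hμ₀2) hm hXm hXlaw hη
  have h2 := tendsto_measure_norm_average_sub_ge continuous_id hid hm hXm hXlaw
    (Real.sqrt_pos.2 hη)
  have h3 := tendsto_measure_norm_average_sub_ge continuous_rankOne_self
    (integrable_rankOne_self hμ₀2) hn hYm hYlaw hη
  have h4 := tendsto_measure_norm_average_sub_ge continuous_id hid hn hYm hYlaw
    (Real.sqrt_pos.2 hη)
  simp only [hμ₀S, id, hμ₀0, sub_zero] at h1 h2 h3 h4
  have hsum := (h1.add h2).add (h3.add h4)
  simp only [add_zero] at hsum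
  have hN : Tendsto (fun j => (m j : ℝ)) atTop atTop := tendsto_natCast_atTop_atTop.comp hm
  refine tendsto_of_tendsto_of_tendsto_of_le_of_le' tendsto_const_nhds hsum
    (Eventually.of_forall fun j => zero_le) ?_
  filter_upwards [hm.eventually_ge_atTop 2, hn.eventually_ge_atTop 2,
    hN.eventually_ge_atTop (2 * ‖S‖ / (ε / 10))] with j hmj hnj hNj
  refine le_trans (measure_mono fun ω hω => ?_) ((measure_union_le _ _).trans
    (add_le_add (measure_union_le _ _) (measure_union_le _ _)))
  by_contra hcon
  simp only [Set.mem_union, Set.mem_ofPred_eq, not_or, not_le] at hcon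
  obtain ⟨⟨b1, b2⟩, b3, b4⟩ := hcon
  refine not_lt.2 (Set.mem_ofPred_eq ▸ hω : ε ≤ _) ?_
  have hmj' : (2 : ℝ) ≤ m j := by exact_mod_cast hmj
  have hnj' : (2 : ℝ) ≤ n j := by exact_mod_cast hnj
  have c1 := norm_inv_smul_scatterOperator_sub_le (by omega) (fun i => X j i ω) a S
  have c2 := norm_inv_smul_scatterOperator_sub_le (by omega) (fun i => Y j i ω) (Δ j + a) S
  simp only [← sub_sub] at c2
  set x := fun i => X j i ω
  set y := fun i => Y j i ω
  have b2' := (Real.lt_sqrt (norm_nonneg _)).1 b2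
  have b4' := (Real.lt_sqrt (norm_nonneg _)).1 b4
  have c1' : ‖scatterOperator x - (m j : ℝ) • S‖ ≤ m j * (ε / 10 + ε / 10) :=
    c1.trans (by gcongr)
  have c2' : ‖scatterOperator y - (n j : ℝ) • S‖ ≤ n j * (ε / 10 + ε / 10) :=
    c2.trans (by gcongr)
  have hD : (0 : ℝ) < m j + n j - 2 := by linarith
  have hdecomp : S - pooledCov x y = -(((m j : ℝ) + n j - 2)⁻¹ •
      ((scatterOperator x - (m j : ℝ) • S) + (scatterOperator y - (n j : ℝ) • S) +
        (2 : ℝ) • S)) := by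
    have : S = ((m j : ℝ) + n j - 2)⁻¹ • (((m j : ℝ) + n j - 2) • S) := by
      rw [smul_smul, inv_mul_cancel₀ hD.ne', one_smul]
    conv_lhs => rw [this]
    rw [pooledCov, ← smul_sub, ← smul_neg]
    congr 1
    module
  rw [hdecomp, norm_neg, norm_smul, Real.norm_of_nonneg (by positivity), inv_mul_lt_iff₀ hD]
  have c3 : ‖(2 : ℝ) • S‖ ≤ m j * (ε / 10) := by
    rw [norm_smul, Real.norm_of_nonneg zero_le_two]
    rwa [div_le_iff₀ hη] at hNj
  calc _ ≤ m j * (ε / 10 + ε / 10) + n j * (ε / 10 + ε / 10) + m j * (ε / 10) :=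
        (norm_add₃_le).trans (add_le_add (add_le_add c1' c2') c3)
    _ < _ := by nlinarith

end Consistency

/-! ### Slutsky-type lemmas on varying probability spaces. -/

section Slutsky

variable {Ω : ℕ → Type*} [∀ j, MeasurableSpace (Ω j)] {P : ∀ j, Measure (Ω j)}
  [∀ j, IsProbabilityMeasure (P j)] {Ω' : Type*} [MeasurableSpace Ω'] {P' : Measure Ω'}
  [IsProbabilityMeasure P']

/-- Slutsky's lemma for random variables on varying probability spaces. -/
theorem tendstoInDistribution_of_tendsto_measure_norm_sub_ge {E : Type*} [NormedAddCommGroup E]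
    [SecondCountableTopology E] [MeasurableSpace E] [BorelSpace E] {X Y : ∀ j, Ω j → E}
    {Z : Ω' → E} (hXZ : TendstoInDistribution X atTop Z P P') (hY : ∀ j, AEMeasurable (Y j) (P j))
    (h : ∀ ε : ℝ, 0 < ε → Tendsto (fun j => P j {ω | ε ≤ ‖Y j ω - X j ω‖}) atTop (𝓝 0)) :
    TendstoInDistribution Y atTop Z P P' := by
  -- All the spaces are coupled in one product, where Slutsky's lemma for a single space applies;
  -- the hypotheses and the conclusion involve each index separately.
  let Q := Measure.infinitePi P
  have hev (j : ℕ) : MeasurePreserving (fun x : ∀ j, Ω j => x j) Q (P j) :=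
    measurePreserving_eval_infinitePi P j
  have hX := hXZ.forall_aemeasurable
  have hXm (j) : AEMeasurable (fun x : ∀ j, Ω j => X j (x j)) Q :=
    (hX j).comp_quasiMeasurePreserving (hev j).quasiMeasurePreserving
  have hYm (j) : AEMeasurable (fun x : ∀ j, Ω j => Y j (x j)) Q :=
    (hY j).comp_quasiMeasurePreserving (hev j).quasiMeasurePreserving
  have hmap {f : ∀ j, Ω j → E} (hf : ∀ j, AEMeasurable (f j) (P j)) (j : ℕ) :
      Q.map (fun x => f j (x j)) = (P j).map (f j) := by
    have h1 : AEMeasurable (f j) (Q.map fun x => x j) := by rw [(hev j).map_eq]; exact hf j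
    have h2 := AEMeasurable.map_map_of_aemeasurable h1 (hev j).measurable.aemeasurable
    rw [(hev j).map_eq] at h2
    exact h2.symm
  have hX' : TendstoInDistribution (fun j (x : ∀ j, Ω j) => X j (x j)) atTop Z (fun _ => Q) P' :=
    tendstoInDistribution_of_eventually_map_eq hXm hXZ.aemeasurable_limit hXZ.tendsto
      (Eventually.of_forall fun j => hmap hX j) rfl
  have hY' := tendstoInDistribution_of_tendstoInMeasure_sub
    (fun j (x : ∀ j, Ω j) => Y j (x j)) Z hX' (by
      rw [tendstoInMeasure_iff_norm]
      intro ε hε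
      refine (h ε hε).congr fun j => ?_
      have hS : NullMeasurableSet {ω | ε ≤ ‖Y j ω - X j ω‖} (P j) :=
        nullMeasurableSet_le aemeasurable_const ((hY j).sub (hX j)).norm
      rw [← (hev j).measure_preimage hS]
      simp) hYm
  exact tendstoInDistribution_of_eventually_map_eq hY hXZ.aemeasurable_limit hY'.tendsto
    (Eventually.of_forall fun j => (hmap hY j).symm) rfl

theorem eventually_measure_norm_ge_lt {E : Type*} [NormedAddCommGroup E]
    [MeasurableSpace E] [BorelSpace E] {X : ∀ j, Ω j → E}
    {Z : Ω' → E} (hXZ : TendstoInDistribution X atTop Z P P') {M : ℝ} {δ : ℝ≥0∞}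
    (hM : P'.map Z {x | M ≤ ‖x‖} < δ) : ∀ᶠ j in atTop, P j {ω | M ≤ ‖X j ω‖} < δ := by
  have hcl : IsClosed {x : E | M ≤ ‖x‖} := isClosed_le continuous_const continuous_norm
  have h := ProbabilityMeasure.limsup_measure_closed_le_of_tendsto hXZ.tendsto hcl
  refine (eventually_lt_of_limsup_lt (h.trans_lt hM)).mono fun j hj => ?_
  rwa [ProbabilityMeasure.coe_mk, Measure.map_apply_of_aemeasurable (hXZ.forall_aemeasurable j)
    hcl.measurableSet] at hj

/-- Outside an event of small probability, ‖Z‖ is below a fixed M, by the second moment of the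
Gaussian limit and the portmanteau theorem, and D is below the threshold; there the error is at most
ηM². -/
theorem tendstoInDistribution_of_abs_sub_le_mul_norm_sq {E : Type*} [NormedAddCommGroup E]
    [NormedSpace ℝ E] [CompleteSpace E]
    [SecondCountableTopology E] [MeasurableSpace E] [BorelSpace E] {Z : ∀ j, Ω j → E}
    {G : Measure E} [IsGaussian G] (hZ : TendstoInDistribution Z atTop (id : E → E) P G)
    {D : ∀ j, Ω j → ℝ}
    (hD : ∀ ε : ℝ, 0 < ε → Tendsto (fun j => P j {ω | ε ≤ D j ω}) atTop (𝓝 0))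
    {f : E → ℝ} (hf : Continuous f) {F : ∀ j, Ω j → ℝ} (hF : ∀ j, AEMeasurable (F j) (P j))
    (h : ∀ η : ℝ, 0 < η → ∃ ε : ℝ, 0 < ε ∧ ∀ j, ∀ᵐ ω ∂(P j), D j ω ≤ ε →
      |F j ω - f (Z j ω)| ≤ η * ‖Z j ω‖ ^ 2) :
    TendstoInDistribution F atTop f P G := by
  refine tendstoInDistribution_of_tendsto_measure_norm_sub_ge
    (hZ.continuous_comp hf) hF fun r hr => ?_
  rw [ENNReal.tendsto_nhds_zero]
  intro δ hδ
  obtain ⟨M, hM0, hM⟩ : ∃ M : ℝ, 0 < M ∧ G {x | M ≤ ‖x‖} < δ / 2 := by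
    obtain ⟨e, he0, heδ⟩ := ENNReal.lt_iff_exists_nnreal_btwn.1 (ENNReal.half_pos hδ.ne')
    have he0' : (0 : ℝ) < e := by exact_mod_cast he0
    set C := ∫ x, ‖x‖ ^ 2 ∂G
    have hC : 0 ≤ C := integral_nonneg fun x => by positivity
    refine ⟨√(C / e + 1), by positivity, ?_⟩
    refine (measure_norm_ge_le (P := G) (f := id) IsGaussian.memLp_two_id (C := C)
      (by positivity) le_rfl).trans_lt (lt_of_le_of_lt ?_ heδ)
    rw [Real.sq_sqrt (by positivity)]
    refine (ENNReal.ofReal_le_ofReal (?_ : _ ≤ (e : ℝ))).trans (by simp)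
    rw [div_le_iff₀ (by positivity)]
    have : (e : ℝ) * (C / e + 1) = C + e := by field_simp
    linarith
  -- With this factor the error is at most r/2 where ‖Z‖ < M.
  obtain ⟨ε, hε0, hε⟩ := h (r / (2 * M ^ 2)) (by positivity)
  have h1 := eventually_measure_norm_ge_lt hZ (by rwa [Measure.map_id])
  have h2 := (ENNReal.tendsto_nhds_zero.1 (hD ε hε0)) (δ / 2) (ENNReal.half_pos hδ.ne')
  filter_upwards [h1, h2] with j hj1 hj2
  have hae : P j {ω | r ≤ ‖F j ω - (f ∘ Z j) ω‖} ≤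
      P j ({ω | M ≤ ‖Z j ω‖} ∪ {ω | ε ≤ D j ω}) := by
    refine measure_mono_ae ?_
    filter_upwards [hε j] with ω hω hr'
    by_contra hcon
    have hcon' : ¬ (M ≤ ‖Z j ω‖ ∨ ε ≤ D j ω) := hcon
    rw [not_or, not_le, not_le] at hcon'
    have h3 := hω hcon'.2.le
    have h4 : r ≤ |F j ω - f (Z j ω)| := hr'
    have h5 : r / (2 * M ^ 2) * ‖Z j ω‖ ^ 2 ≤ r / (2 * M ^ 2) * M ^ 2 := by
      gcongr; exact hcon'.1.le
    have h6 : r / (2 * M ^ 2) * M ^ 2 = r / 2 := by field_simp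
    linarith
  refine hae.trans ((measure_union_le _ _).trans ?_)
  calc _ ≤ δ / 2 + δ / 2 := add_le_add hj1.le hj2
    _ = δ := ENNReal.add_halves δ

theorem _root_.MeasureTheory.TendstoInDistribution.congr_limit {E : Type*} [TopologicalSpace E]
    [MeasurableSpace E] [OpensMeasurableSpace E] {X : ∀ j, Ω j → E} {Z : Ω' → E}
    (h : TendstoInDistribution X atTop Z P P') {Ω'' : Type*} [MeasurableSpace Ω'']
    {P'' : Measure Ω''} [IsProbabilityMeasure P''] {Z' : Ω'' → E} (hZ' : AEMeasurable Z' P'')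
    (hmap : P''.map Z' = P'.map Z) : TendstoInDistribution X atTop Z' P P'' :=
  tendstoInDistribution_of_eventually_map_eq h.forall_aemeasurable hZ' h.tendsto
    (Eventually.of_forall fun _ => rfl) hmap

end Slutsky

/-! ### Squared Gaussian coordinates and noncentral chi-square laws. -/

section LimitLaw

/-- Rescaling N(√(β²/λ), 1) by √λ gives N(|β|, λ); the sign of β is lost on squaring, by the
symmetry w ↦ −w. -/
theorem map_sq_gaussianReal {β lam : ℝ} (hlam : 0 < lam) :
    (gaussianReal β lam.toNNReal).map (fun w => w ^ 2) =
      (noncentralChiSq (β ^ 2 / lam)).map (fun c => lam * c) := by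
  have h1 : (noncentralChiSq (β ^ 2 / lam)).map (fun c => lam * c) =
      (gaussianReal |β| lam.toNNReal).map (fun w => w ^ 2) := by
    have hg : gaussianReal |β| lam.toNNReal =
        (gaussianReal (√(β ^ 2 / lam)) 1).map (fun w => √lam * w) := by
      rw [gaussianReal_map_const_mul]
      congr 1
      · rw [← Real.sqrt_mul hlam.le, mul_div_cancel₀ _ hlam.ne', Real.sqrt_sq_eq_abs]
      · ext
        simp [Real.sq_sqrt hlam.le, hlam.le]
    rw [noncentralChiSq, hg, Measure.map_map (by fun_prop) (by fun_prop),
      Measure.map_map (by fun_prop) (by fun_prop)]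
    congr 1
    ext w
    simp [mul_pow, Real.sq_sqrt hlam.le]
  rw [h1]
  rcases abs_choice β with h | h
  · rw [h]
  · have : gaussianReal (-β) lam.toNNReal =
        (gaussianReal β lam.toNNReal).map (fun w => -w) := (gaussianReal_map_neg).symm
    rw [h, this, Measure.map_map (by fun_prop) (by fun_prop)]
    congr 1
    ext w
    simp

variable {H : Type*} [NormedAddCommGroup H] [InnerProductSpace ℝ H] [CompleteSpace H]
  [SecondCountableTopology H] [MeasurableSpace H] [BorelSpace H]

/-- The coordinates of a Gaussian vector along orthonormal eigenvectors of its covariance are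
independent Gaussian variables. -/
theorem map_inner_eq_pi_gaussianReal {G : Measure H} [IsGaussian G] {ι : Type*} [Fintype ι]
    {psi : ι → H} (hpsi : Orthonormal ℝ psi) {lam : ι → ℝ} (hlam : ∀ k, 0 ≤ lam k)
    (heig : ∀ k, covOperator G (psi k) = lam k • psi k) :
    G.map (fun x k => ⟪x, psi k⟫_ℝ) =
      Measure.pi fun k => gaussianReal ⟪∫ y, y ∂G, psi k⟫_ℝ (lam k).toNNReal := by
  classical
  rw [← charFun_eq_pi_iff]
  intro t
  have hm : Measurable fun (x : H) (k : ι) => ⟪x, psi k⟫_ℝ :=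
    measurable_pi_lambda _ fun k => by fun_prop
  rw [Measure.map_map (by fun_prop) hm]
  have h1 : charFun (G.map ((WithLp.toLp 2) ∘ fun (x : H) (k : ι) => ⟪x, psi k⟫_ℝ)) t =
      charFun G (∑ k, t k • psi k) := by
    rw [charFun_apply, charFun_apply, integral_map
      (Measurable.aemeasurable ((WithLp.measurable_toLp 2 _).comp hm))
      (Continuous.aestronglyMeasurable (by fun_prop))]
    congr with x
    congr 3
    simp only [Function.comp_apply, PiLp.inner_apply, inner_sum, inner_smul_right,
      RCLike.inner_apply, conj_trivial]
  have h2 (k : ι) : covarianceBilin G (psi k) (∑ l, t l • psi l) = lam k * t k := by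
    have h3 : covarianceBilin G (psi k) (∑ l, t l • psi l) =
        ⟪covOperator G (psi k), ∑ l, t l • psi l⟫_ℝ := by
      rw [covOperator, InnerProductSpace.continuousLinearMapOfBilin_apply]
    rw [h3, heig, inner_smul_left, hpsi.inner_right_fintype, conj_trivial]
  have h4 : covarianceBilin G (∑ k, t k • psi k) (∑ l, t l • psi l) = ∑ k, lam k * t k ^ 2 := by
    have h5 : covarianceBilin G (∑ k, t k • psi k) = ∑ k, t k • covarianceBilin G (psi k) := by
      simp
    rw [h5, _root_.sum_apply]
    refine Finset.sum_congr rfl fun k _ => ?_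
    rw [_root_.smul_apply, h2, smul_eq_mul]
    ring
  rw [h1, IsGaussian.charFun_eq', h4]
  simp only [charFun_gaussianReal, ← Complex.exp_sum]
  rw [Finset.sum_sub_distrib, sum_inner]
  push_cast
  rw [Finset.sum_mul, Finset.sum_div]
  congr 2
  · refine Finset.sum_congr rfl fun k _ => ?_
    rw [inner_smul_left, real_inner_comm]
    simp
  · refine Finset.sum_congr rfl fun k _ => ?_
    simp [(hlam k)]

/-- The squared coordinates of a Gaussian vector along orthonormal eigenvectors of its covariance
are independent scaled noncentral chi-square variables. -/
theorem map_inner_sq_eq_map_pi_noncentralChiSq {G : Measure H} [IsGaussian G] {ι : Type*}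
    [Fintype ι] {psi : ι → H} (hpsi : Orthonormal ℝ psi) {lam : ι → ℝ} (hlam : ∀ k, 0 < lam k)
    (heig : ∀ k, covOperator G (psi k) = lam k • psi k) :
    G.map (fun x k => ⟪x, psi k⟫_ℝ ^ 2) =
      (Measure.pi fun k => noncentralChiSq (⟪∫ y, y ∂G, psi k⟫_ℝ ^ 2 / lam k)).map
        (fun c k => lam k * c k) := by
  have hm : Measurable fun (x : H) (k : ι) => ⟪x, psi k⟫_ℝ :=
    measurable_pi_lambda _ fun k => by fun_prop
  have hs : Measurable fun (y : ι → ℝ) (k : ι) => y k ^ 2 :=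
    measurable_pi_lambda _ fun k => by fun_prop
  have h1 : G.map (fun x k => ⟪x, psi k⟫_ℝ ^ 2) =
      (G.map (fun x k => ⟪x, psi k⟫_ℝ)).map (fun (y : ι → ℝ) (k : ι) => y k ^ 2) := by
    rw [Measure.map_map hs hm]
    rfl
  have (k : ι) : IsProbabilityMeasure
      ((noncentralChiSq (⟪∫ y, y ∂G, psi k⟫_ℝ ^ 2 / lam k)).map fun c => lam k * c) :=
    Measure.isProbabilityMeasure_map (by fun_prop)
  have (k : ι) : IsProbabilityMeasure
      ((gaussianReal ⟪∫ y, y ∂G, psi k⟫_ℝ (lam k).toNNReal).map fun w => w ^ 2) :=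
    Measure.isProbabilityMeasure_map (by fun_prop)
  rw [h1, map_inner_eq_pi_gaussianReal hpsi (fun k => (hlam k).le) heig,
    Measure.pi_map_pi (f := fun _ w => w ^ 2) fun k => by fun_prop,
    Measure.pi_map_pi (f := fun k c => lam k * c) fun k => by fun_prop]
  simp only [map_sq_gaussianReal (hlam _)]

omit [SecondCountableTopology H] in
theorem covOperator_congr {μ ν : Measure H} (h : covarianceBilinDual μ = covarianceBilinDual ν) :
    covOperator μ = covOperator ν := by
  simp only [covOperator, covarianceBilin, h]

end LimitLaw

/-! ### The projection statistics, and part (b). -/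

section Projection

variable {H : Type*} [NormedAddCommGroup H] [InnerProductSpace ℝ H]

theorem mul_THKR1_eq {m n L : ℕ} (psi : Fin L → H) (x : Fin m → H) (y : Fin n → H) :
    (m : ℝ) * n / (m + n) * THKR1 psi x y = ∑ k, ⟪meanDiff x y, psi k⟫_ℝ ^ 2 := by
  rw [THKR1, Finset.mul_sum]
  refine Finset.sum_congr rfl fun k _ => ?_
  rw [meanDiff, inner_smul_left, conj_trivial, mul_pow, Real.sq_sqrt (by positivity),
    ← neg_sub (sampleMean x), inner_neg_left, neg_sq]

theorem mul_THKR2_eq {m n L : ℕ} (lam : Fin L → ℝ) (psi : Fin L → H) (x : Fin m → H)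
    (y : Fin n → H) :
    (m : ℝ) * n / (m + n) * THKR2 lam psi x y =
      ∑ k, (lam k)⁻¹ * ⟪meanDiff x y, psi k⟫_ℝ ^ 2 := by
  rw [THKR2, Finset.mul_sum]
  refine Finset.sum_congr rfl fun k _ => ?_
  rw [meanDiff, inner_smul_left, conj_trivial, mul_pow, Real.sq_sqrt (by positivity),
    ← neg_sub (sampleMean x), inner_neg_left, neg_sq]
  ring

theorem abs_sum_sub_sum_le_of_le {L : ℕ} {a b : Fin L → ℝ} {η c : ℝ} (hη : 0 ≤ η) (hc : 0 ≤ c)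
    (h : ∀ k, |a k - b k| ≤ η / (L + 1) * c) : |∑ k, a k - ∑ k, b k| ≤ η * c := by
  rw [← Finset.sum_sub_distrib]
  refine (Finset.abs_sum_le_sum_abs _ _).trans ((Finset.sum_le_sum fun k _ => h k).trans ?_)
  rw [Finset.sum_const, Finset.card_univ, Fintype.card_fin, nsmul_eq_mul]
  have h1 : (L : ℝ) * (η / (L + 1) * c) = η * c * (L / (L + 1)) := by ring
  rw [h1]
  refine mul_le_of_le_one_right (by positivity) ?_
  rw [div_le_one (by positivity)]
  linarith

theorem abs_inv_mul_sub_inv_mul_le {l l' s s' η c : ℝ} (hl : 0 < l) (hη : 0 ≤ η)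
    (hηl : η ≤ l / 2) (hll : |l' - l| ≤ η) (hss : |s' - s| ≤ 2 * η * c) (hs : 0 ≤ s)
    (hsc : s ≤ c) : |l'⁻¹ * s' - l⁻¹ * s| ≤ η * (4 / l + 2 / l ^ 2) * c := by
  have hl' : l / 2 ≤ l' := by
    have := (abs_le.1 hll).1
    linarith
  have hl'0 : 0 < l' := by linarith
  have hinv : l'⁻¹ ≤ 2 / l := by
    rw [inv_le_comm₀ hl'0 (by positivity), inv_div]
    exact hl'
  have h1 : l'⁻¹ * s' - l⁻¹ * s = l'⁻¹ * (s' - s) + l'⁻¹ * l⁻¹ * (l - l') * s := by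
    field_simp
    ring
  rw [h1]
  calc |l'⁻¹ * (s' - s) + l'⁻¹ * l⁻¹ * (l - l') * s|
      ≤ l'⁻¹ * |s' - s| + l'⁻¹ * l⁻¹ * |l' - l| * s := by
        refine (abs_add_le _ _).trans ?_
        rw [abs_mul, abs_mul, abs_mul, abs_mul, abs_inv, abs_inv, abs_of_pos hl'0, abs_of_pos hl,
          abs_sub_comm l l', abs_of_nonneg hs]
    _ ≤ 2 / l * (2 * η * c) + 2 / l * l⁻¹ * η * c := by gcongr
    _ = η * (4 / l + 2 / l ^ 2) * c := by
        field_simp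
        ring

variable [CompleteSpace H] [SecondCountableTopology H] [MeasurableSpace H] [BorelSpace H]

omit [CompleteSpace H] in
theorem aemeasurable_sampleMean {Ω : Type*} [MeasurableSpace Ω] {P : Measure Ω} {n : ℕ}
    {X : Fin n → Ω → H} (hX : ∀ i, AEMeasurable (X i) P) :
    AEMeasurable (fun ω => sampleMean fun i => X i ω) P := by
  unfold sampleMean
  fun_prop

omit [CompleteSpace H] in
theorem aemeasurable_inner_scatterOperator {Ω : Type*} [MeasurableSpace Ω] {P : Measure Ω}
    {n : ℕ} {X : Fin n → Ω → H} (hX : ∀ i, AEMeasurable (X i) P) {u : Ω → H}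
    (hu : AEMeasurable u P) :
    AEMeasurable (fun ω => ⟪u ω, scatterOperator (fun i => X i ω) (u ω)⟫_ℝ) P := by
  have := aemeasurable_sampleMean hX
  simp only [scatterOperator, _root_.sum_apply, InnerProductSpace.rankOne_apply, inner_sum,
    inner_smul_right]
  fun_prop

omit [CompleteSpace H] in
/-- Measurably chosen eigenvectors of the pooled covariance have measurable eigenvalues. -/
theorem aemeasurable_eigenvalue_pooledCov {Ω : Type*} [MeasurableSpace Ω] {P : Measure Ω}
    {m n L : ℕ} {X : Fin m → Ω → H} {Y : Fin n → Ω → H} (hX : ∀ i, AEMeasurable (X i) P)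
    (hY : ∀ i, AEMeasurable (Y i) P) {lam : Fin L → Ω → ℝ} {psi : Fin L → Ω → H}
    (hpsi : ∀ k, AEMeasurable (psi k) P)
    (h : ∀ᵐ ω ∂P, IsLeadingEigensystem (pooledCov (fun i => X i ω) (fun i => Y i ω))
      (fun k => lam k ω) (fun k => psi k ω)) (k : Fin L) : AEMeasurable (lam k) P := by
  -- The eigenvalue is the Rayleigh quotient at its unit eigenvector, a measurable expression in the
  -- data and the eigenvector.
  have h1 : AEMeasurable (fun ω => ((m : ℝ) + n - 2)⁻¹ *
      (⟪psi k ω, scatterOperator (fun i => X i ω) (psi k ω)⟫_ℝ +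
        ⟪psi k ω, scatterOperator (fun i => Y i ω) (psi k ω)⟫_ℝ)) P :=
    ((aemeasurable_inner_scatterOperator hX (hpsi k)).add
      (aemeasurable_inner_scatterOperator hY (hpsi k))).const_mul _
  refine h1.congr ?_
  filter_upwards [h] with ω hω
  have h2 : ⟪psi k ω, pooledCov (fun i => X i ω) (fun i => Y i ω) (psi k ω)⟫_ℝ = lam k ω := by
    rw [hω.eigen k, inner_smul_right, real_inner_self_eq_norm_sq, hω.orthonormal.1 k]
    ring
  rw [← h2, pooledCov, _root_.smul_apply, _root_.add_apply, inner_smul_right, inner_add_right]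

section Main

variable {m n : ℕ → ℕ}
  {Ω : ℕ → Type*} [∀ j, MeasurableSpace (Ω j)] {P : ∀ j, Measure (Ω j)}
  [∀ j, IsProbabilityMeasure (P j)] {μ : Measure H} [IsProbabilityMeasure μ]

/-- The projection statistics `T_HKR1` and `T_HKR2` converge weakly to (weighted) sums of
independent noncentral chi-square variables. -/
theorem tendstoInDistribution_THKR (hm : Tendsto m atTop atTop) (hn : Tendsto n atTop atTop)
    {δ : H} {X : ∀ j, Fin (m j) → Ω j → H} {Y : ∀ j, Fin (n j) → Ω j → H}
    (h : ∀ j, IsShiftedTwoSample (P j) μ (shrinkingShift δ (m j) (n j)) (X j) (Y j))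
    (hμ : MemLp id 2 μ) {L : ℕ} {lam : Fin (L + 1) → ℝ} {psi : Fin (L + 1) → H}
    (hsys : IsLeadingEigensystem (covOperator μ) lam psi) (hlam : StrictAnti lam)
    (hpos : 0 < lam (Fin.last L)) {lamHat : ∀ j, Fin L → Ω j → ℝ} {psiHat : ∀ j, Fin L → Ω j → H}
    (hpsi : ∀ j k, AEMeasurable (psiHat j k) (P j))
    (hhat : ∀ j, ∀ᵐ ω ∂(P j), IsLeadingEigensystem
      (pooledCov (fun i => X j i ω) (fun i => Y j i ω))
      (fun k => lamHat j k ω) (fun k => psiHat j k ω)) :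
    TendstoInDistribution
        (fun j ω => (m j : ℝ) * n j / (m j + n j) *
          THKR1 (fun k => psiHat j k ω) (fun i => X j i ω) (fun i => Y j i ω))
        atTop (fun c : Fin L → ℝ => ∑ k : Fin L, lam k.castSucc * c k) P
        (Measure.pi (fun k : Fin L =>
          noncentralChiSq (⟪δ, psi k.castSucc⟫_ℝ ^ 2 / lam k.castSucc))) ∧
      TendstoInDistribution
        (fun j ω => (m j : ℝ) * n j / (m j + n j) *
          THKR2 (fun k => lamHat j k ω) (fun k => psiHat j k ω)
            (fun i => X j i ω) (fun i => Y j i ω))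
        atTop (fun c : Fin L → ℝ => ∑ k : Fin L, c k) P
        (Measure.pi (fun k : Fin L =>
          noncentralChiSq (⟪δ, psi k.castSucc⟫_ℝ ^ 2 / lam k.castSucc))) := by
  obtain ⟨G, hG, hmean, hcov, hZ⟩ := exists_isGaussian_tendstoInDistribution_meanDiff
    isTypeTwo_of_innerProductSpace hm hn h hμ
  have hD (ε : ℝ) (hε : 0 < ε) :=
    tendsto_measure_norm_covOperator_sub_pooledCov_ge hm hn h hμ hε
  have hpert {η : ℝ} (hη : 0 < η) := hsys.exists_perturbation_bound
    (isCompactOperator_covOperator hμ) (isSymmetric_covOperator μ) hlam hη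
  have hX (j) (i) : AEMeasurable (X j i) (P j) := ((h j).law_X i).aemeasurable
  have hY (j) (i) : AEMeasurable (Y j i) (P j) := ((h j).law_Y i).aemeasurable
  have hlamHat (j) := aemeasurable_eigenvalue_pooledCov (hX j) (hY j) (hpsi j) (hhat j)
  have hZm := hZ.forall_aemeasurable
  have hlam_pos (k : Fin L) : 0 < lam k.castSucc :=
    hpos.trans (hlam (Fin.castSucc_lt_last k))
  have hinner (z : H) (k : Fin L) : ⟪z, psi k.castSucc⟫_ℝ ^ 2 ≤ ‖z‖ ^ 2 := by
    have h1 := abs_real_inner_le_norm z (psi k.castSucc)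
    rw [hsys.orthonormal.1, mul_one] at h1
    exact sq_le_sq' (abs_le.1 h1).1 (abs_le.1 h1).2
  have hlaw := map_inner_sq_eq_map_pi_noncentralChiSq (G := G)
    (psi := fun k : Fin L => psi k.castSucc)
    (hsys.orthonormal.comp _ (Fin.castSucc_injective L)) hlam_pos fun k => by
      rw [covOperator_congr hcov, hsys.eigen]
  rw [hmean] at hlaw
  have hmapf {g : (Fin L → ℝ) → ℝ} (hg : Measurable g) :
      (Measure.pi fun k : Fin L =>
        noncentralChiSq (⟪δ, psi k.castSucc⟫_ℝ ^ 2 / lam k.castSucc)).map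
          (fun c => g fun k => lam k.castSucc * c k) =
        G.map fun z => g fun k => ⟪z, psi k.castSucc⟫_ℝ ^ 2 := by
    have h1 := congrArg (Measure.map g) hlaw
    rw [Measure.map_map hg (measurable_pi_lambda _ fun k => by fun_prop),
      Measure.map_map hg (measurable_pi_lambda _ fun k => by fun_prop)] at h1
    exact h1.symm
  simp only [mul_THKR1_eq, mul_THKR2_eq]
  constructor
  · have hlim := tendstoInDistribution_of_abs_sub_le_mul_norm_sq hZ hD
      (f := fun z => ∑ k : Fin L, ⟪z, psi k.castSucc⟫_ℝ ^ 2) (by fun_prop)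
      (F := fun j ω => ∑ k : Fin L,
        ⟪meanDiff (fun i => X j i ω) (fun i => Y j i ω), psiHat j k ω⟫_ℝ ^ 2)
      (fun j => by
        have := hZm j
        have := hpsi j
        fun_prop)
      (fun η hη => by
        -- The 2 absorbs the factor in the perturbation bound; L + 1 shares the error among the L
        -- summands and stays positive for every L.
        obtain ⟨ε, hε, hB⟩ := hpert (η := η / (L + 1) / 2) (by positivity)
        refine ⟨ε, hε, fun j => ?_⟩
        filter_upwards [hhat j] with ω hω hDω
        refine abs_sum_sub_sum_le_of_le hη.le (by positivity) fun k => ?_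
        refine ((hB _ _ _ (isCompactOperator_pooledCov _ _) (isSymmetric_pooledCov _ _) hω hDω
          k).2 _).trans_eq ?_
        ring)
    refine hlim.congr_limit (Measurable.aemeasurable (by fun_prop)) ?_
    exact hmapf (g := fun c => ∑ k, c k) (by fun_prop)
  · have hlim := tendstoInDistribution_of_abs_sub_le_mul_norm_sq hZ hD
      (f := fun z => ∑ k : Fin L, (lam k.castSucc)⁻¹ * ⟪z, psi k.castSucc⟫_ℝ ^ 2) (by fun_prop)
      (F := fun j ω => ∑ k : Fin L, (lamHat j k ω)⁻¹ *
        ⟪meanDiff (fun i => X j i ω) (fun i => Y j i ω), psiHat j k ω⟫_ℝ ^ 2)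
      (fun j => by
        have := hZm j
        have := hpsi j
        have := hlamHat j
        fun_prop)
      (fun η hη => by
        set l := lam (Fin.last L)
        set C := 4 / l + 2 / l ^ 2
        have hC : 0 < C := by positivity
        -- The first bound keeps the empirical eigenvalues above λₖ/2, so their inverses are
        -- controlled. In the second, `C` is the constant of `abs_inv_mul_sub_inv_mul_le` at the
        -- smallest eigenvalue `l`, which dominates those at the other λₖ.
        obtain ⟨ε, hε, hB⟩ := hpert (η := min (l / 2) (η / (L + 1) / C)) (by positivity)
        refine ⟨ε, hε, fun j => ?_⟩
        filter_upwards [hhat j] with ω hω hDω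
        refine abs_sum_sub_sum_le_of_le hη.le (by positivity) fun k => ?_
        obtain ⟨h1, h2⟩ := hB _ _ _ (isCompactOperator_pooledCov _ _) (isSymmetric_pooledCov _ _)
          hω hDω k
        have hlk : l ≤ lam k.castSucc := (hlam (Fin.castSucc_lt_last k)).le
        refine (abs_inv_mul_sub_inv_mul_le (hlam_pos k) (by positivity)
          ((min_le_left _ _).trans (by linarith)) h1 (h2 _) (by positivity)
          (hinner _ k)).trans ?_
        refine mul_le_mul_of_nonneg_right ?_ (by positivity)
        calc min (l / 2) (η / (L + 1) / C) * (4 / lam k.castSucc + 2 / lam k.castSucc ^ 2)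
            ≤ η / (L + 1) / C * (4 / l + 2 / l ^ 2) := by
              have := hlam_pos k
              gcongr
              exact min_le_right _ _
          _ = η / (L + 1) := div_mul_cancel₀ _ hC.ne')
    refine hlim.congr_limit (Measurable.aemeasurable (by fun_prop)) ?_
    -- The weights 1/λₖ cancel the scale factors λₖ in the law of the squared coordinates.
    rw [← hmapf (g := fun c => ∑ k : Fin L, (lam k.castSucc)⁻¹ * c k) (by fun_prop)]
    congr with c
    refine Finset.sum_congr rfl fun k _ => ?_
    rw [inv_mul_cancel_left₀ (hlam_pos k).ne']

end Main

end Projection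

end TwoSample

end

theorem theorem3
    -- the sample sizes
    (m n : ℕ → ℕ) (γ : ℝ) (hγ : γ ∈ Set.Ioo (0 : ℝ) 1)
    (hm : Tendsto m atTop atTop) (hn : Tendsto n atTop atTop)
    (hmn : Tendsto (fun j => (m j : ℝ) / (m j + n j)) atTop (𝓝 γ))
    -- the probability spaces carrying the samples
    (Ω : ℕ → Type*) [∀ j, MeasurableSpace (Ω j)]
    (P : ∀ j, Measure (Ω j)) [∀ j, IsProbabilityMeasure (P j)] :
    -- (a)
    (∀ (E : Type*) [NormedAddCommGroup E] [NormedSpace ℝ E] [CompleteSpace E]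
        [SecondCountableTopology E] [MeasurableSpace E] [BorelSpace E],
      TwoSample.IsTypeTwo E →
      ∀ (μ : Measure E) [IsProbabilityMeasure μ] (δ : E), δ ≠ 0 →
      ∀ (X : ∀ j, Fin (m j) → Ω j → E) (Y : ∀ j, Fin (n j) → Ω j → E),
      (∀ j, TwoSample.IsShiftedTwoSample (P j) μ (TwoSample.shrinkingShift δ (m j) (n j))
        (X j) (Y j)) →
      MemLp id 2 μ →
      ∃ (G : Measure E) (_ : IsGaussian G),
        ∫ x, x ∂G = δ ∧ covarianceBilinDual G = covarianceBilinDual μ ∧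
        TendstoInDistribution
          (fun j ω => (n j : ℝ) / (m j + n j) *
            TwoSample.TCFF (fun i => X j i ω) (fun i => Y j i ω))
          atTop (fun x : E => ‖x‖ ^ 2) P G) ∧
    -- (b)
    (∀ (H : Type*) [NormedAddCommGroup H] [InnerProductSpace ℝ H] [CompleteSpace H]
        [SecondCountableTopology H] [MeasurableSpace H] [BorelSpace H]
        (μ : Measure H) [IsProbabilityMeasure μ] (δ : H), δ ≠ 0 →
      ∀ (X : ∀ j, Fin (m j) → Ω j → H) (Y : ∀ j, Fin (n j) → Ω j → H),
      (∀ j, TwoSample.IsShiftedTwoSample (P j) μ (TwoSample.shrinkingShift δ (m j) (n j))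
        (X j) (Y j)) →
      MemLp id 4 μ →
      -- the `L + 1` largest eigenvalues of the covariance are distinct and positive
      ∀ (L : ℕ), 1 ≤ L →
      ∀ (lam : Fin (L + 1) → ℝ) (psi : Fin (L + 1) → H),
      TwoSample.IsLeadingEigensystem (TwoSample.covOperator μ) lam psi →
      StrictAnti lam → 0 < lam (Fin.last L) →
      -- the empirical eigenvalues and (any measurable choice of) empirical eigenvectors
      ∀ (lamHat : ∀ j, Fin L → Ω j → ℝ) (psiHat : ∀ j, Fin L → Ω j → H),
      (∀ j k, AEMeasurable (psiHat j k) (P j)) →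
      (∀ j, ∀ᵐ ω ∂(P j), TwoSample.IsLeadingEigensystem
        (TwoSample.pooledCov (fun i => X j i ω) (fun i => Y j i ω))
        (fun k => lamHat j k ω) (fun k => psiHat j k ω)) →
      TendstoInDistribution
          (fun j ω => (m j : ℝ) * n j / (m j + n j) *
            TwoSample.THKR1 (fun k => psiHat j k ω) (fun i => X j i ω) (fun i => Y j i ω))
          atTop (fun c : Fin L → ℝ => ∑ k : Fin L, lam k.castSucc * c k) P
          (Measure.pi (fun k : Fin L =>
            TwoSample.noncentralChiSq (⟪δ, psi k.castSucc⟫_ℝ ^ 2 / lam k.castSucc))) ∧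
      TendstoInDistribution
          (fun j ω => (m j : ℝ) * n j / (m j + n j) *
            TwoSample.THKR2 (fun k => lamHat j k ω) (fun k => psiHat j k ω)
              (fun i => X j i ω) (fun i => Y j i ω))
          atTop (fun c : Fin L → ℝ => ∑ k : Fin L, c k) P
          (Measure.pi (fun k : Fin L =>
            TwoSample.noncentralChiSq (⟪δ, psi k.castSucc⟫_ℝ ^ 2 / lam k.castSucc)))) := by
  refine ⟨?_, ?_⟩
  · intro E _ _ _ _ _ _ hE μ _ δ _ X Y h hμ
    exact TwoSample.exists_isGaussian_tendstoInDistribution_TCFF hE hm hn h hμ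
  · intro H _ _ _ _ _ _ μ _ δ _ X Y h hμ L _ lam psi hsys hlam hpos lamHat psiHat hpsi hhat
    exact TwoSample.tendstoInDistribution_THKR hm hn h (hμ.mono_exponent (by norm_num)) hsys hlam
      hpos hpsi hhat
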